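/- There is an absolute constant $p_0$ such that for all $C_0,C_1>0$ there are constants $C_2,C_3>0$, depending only on $C_0$ and $C_1$, for which the following holds. **Setting.** Let $n\ge 1$, $p\ge p_0$, $1\le s^*\le s\le 4s^*$ and $s\le s_{\max}\le p$ be integers with $n\ge C_0\,s_{\max}\log(p/s_{\max})$. Let $X\in\mathbb R^{n\times p}$ have columns of Euclidean norm $n^{1/2}$ and satisfy the restricted isometry property of order $3s$ with a constant $\delta\in(0,1)$: $(1-\delta)\,n\|u\|_2^2\le\|Xu\|_2^2\le(1+\delta)\,n\|u\|_2^2$ for every $u\in\mathbb R^p$ supported on at most $3s$ coordinates. Let $0<\varepsilon<1$ with $\delta<\min(\varepsilon^2,0.005)$. Let $\sigma>0$ and let $\lambda$ satisfy $$\lambda\ \ge\ (1+3\varepsilon)\,\sigma\Big(\frac{2\log(p/s^*)}{n}\Big)^{1/2}\quad\text{and}\quad \lambda\ \ge\ (C_1\vee 4)\,\sigma\Big(\frac{2\log p}{n}\Big)^{1/2}.$$ We observe $y=X\beta^*+\xi$, where $\xi_1,\dots,\xi_n$ are i.i.d. with mean zero and $\mathrm{pr}(|\xi_i|>r)\le 2\exp\{-r^2/(2\sigma^2)\}$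 for all $r\ge0$. Let $\Omega^p_{s^*,\lambda}$ be the set of $\beta\in\mathbb R^p$ with at most $s^*$ nonzero entries, all of magnitude at least $\lambda$. **Algorithm.** Hard thresholding pursuit with model size $s$ starts from a (possibly data-dependent) $\beta^0$ with at most $s$ nonzero entries and $\|\beta^0-\beta^*\|_2\le C_1\sigma\{s^*\log(p/s^*)/n\}^{1/2}$ almost surely. For $t\ge0$, the set $S^{t+1}$ consists of $s$ coordinates carrying the $s$ largest magnitudes of $\beta^t+X^\top(y-X\beta^t)/n$ (ties broken arbitrarily), and $\beta^{t+1}$ minimizes $\|y-X\beta\|_2$ over all $\beta$ that vanish outside $S^{t+1}$. Let $\lambda_{s,t}=\min_{i\in S^t}|\beta^t_i|$ be the minimum signal strength at step $t$; it is the smallest nonzero magnitude of $\beta^t$ whenever $\beta^t$ has $s$ nonzero entries. **Claim.** For every integer $t\ge 2\log(C_2^2s^*)$: 1. if $s=s^*$, then for every $\beta^*\in\Omega^p_{s^*,\lambda}$ with exactly $s^*$ nonzero entries, $$\mathrm{pr}\Big\{\lambda_{s^*,t}<\big((C_1-2)\vee2\big)\,\sigma\Big(\frac{2\log p}{n}\Big)^{1/2}\Big\}\le\Big(\frac{s^*}{p}\Big)^{C_3};$$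 2. if $s^*<s\le4s^*$, then for every $\beta^*\in\Omega^p_{s^*,\lambda}$, $$\mathrm{pr}\Big\{\lambda_{s,t}\ge2\sigma\Big(\frac{2\log p}{n}\Big)^{1/2}\Big\}\le\Big(\frac{s^*}{p}\Big)^{C_3}.$$ -/

import Mathlib

open MeasureTheory ProbabilityTheory
open scoped Matrix

/-- Euclidean norm of a real vector (plain functions carry the sup norm in Mathlib). -/
noncomputable def l2norm {ι : Type*} [Fintype ι] (v : ι → ℝ) : ℝ :=
  ‖(WithLp.toLp 2 v : EuclideanSpace ℝ ι)‖

/-- The support set of a vector. -/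
noncomputable def vsupp {p : ℕ} (b : Fin p → ℝ) : Finset (Fin p) :=
  Finset.univ.filter fun i => b i ≠ 0

/-- Restricted isometry property of order `k` with constant `δ`, for a design with `n` rows.
A vector `u` indexed by a set `S` of columns is represented by its extension by zero, so that
`X *ᵥ u` is `X_S u`; the quotient `‖X_S u‖² / (n ‖u‖²)` is cleared of its denominator. -/
def RIP {n p : ℕ} (X : Matrix (Fin n) (Fin p) ℝ) (k : ℕ) (δ : ℝ) : Prop :=
  0 < δ ∧ δ < 1 ∧
    ∀ S : Finset (Fin p), S.card ≤ k → ∀ u : Fin p → ℝ, (∀ i, i ∉ S → u i = 0) →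
      (1 - δ) * (n * l2norm u ^ 2) ≤ l2norm (X *ᵥ u) ^ 2 ∧
        l2norm (X *ᵥ u) ^ 2 ≤ (1 + δ) * (n * l2norm u ^ 2)

/-- The errors are i.i.d., centred, with sub-Gaussian tails of scale `σ`. -/
structure IsSubGaussianNoise {Ω : Type*} [MeasurableSpace Ω] (μ : Measure Ω) {n : ℕ}
    (ξ : Fin n → Ω → ℝ) (σ : ℝ) : Prop where
  measurable : ∀ i, Measurable (ξ i)
  indep : iIndepFun ξ μ
  identDistrib : ∀ i j, IdentDistrib (ξ i) (ξ j) μ μ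
  mean_zero : ∀ i, ∫ ω, ξ i ω ∂μ = 0
  tail : ∀ i, ∀ t : ℝ, 0 ≤ t →
    μ.real {ω | t < |ξ i ω|} ≤ 2 * Real.exp (-(t ^ 2) / (2 * σ ^ 2))

/-- Vectors with at most `sstar` nonzero entries, each of magnitude at least `lam`. -/
def signalClass (p sstar : ℕ) (lam : ℝ) : Set (Fin p → ℝ) :=
  {b | (vsupp b).card ≤ sstar ∧ ∀ i ∈ vsupp b, lam ≤ |b i|}

/-- `S` is a set of `s` coordinates that hold the `s` largest magnitudes of `v`, i.e. a set of
coordinates that the hard thresholding operator may retain (ties are broken arbitrarily). -/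
def IsTopSet {p : ℕ} (s : ℕ) (v : Fin p → ℝ) (S : Finset (Fin p)) : Prop :=
  S.card = s ∧ ∀ i ∈ S, ∀ j, j ∉ S → |v j| ≤ |v i|

/-- `b` is a least-squares fit of `y` on the columns in `S`. -/
def IsLeastSquaresOn {n p : ℕ} (X : Matrix (Fin n) (Fin p) ℝ) (y : Fin n → ℝ)
    (S : Finset (Fin p)) (b : Fin p → ℝ) : Prop :=
  (∀ i, i ∉ S → b i = 0) ∧
    ∀ c : Fin p → ℝ, (∀ i, i ∉ S → c i = 0) → l2norm (y - X *ᵥ b) ≤ l2norm (y - X *ᵥ c)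

/-- The gradient step `b + Xᵀ (y - X b) / n`. -/
noncomputable def gradStep {n p : ℕ} (X : Matrix (Fin n) (Fin p) ℝ) (y : Fin n → ℝ)
    (b : Fin p → ℝ) : Fin p → ℝ :=
  b + (n : ℝ)⁻¹ • (Xᵀ *ᵥ (y - X *ᵥ b))

/-- `(β t, S t)`, `t = 0, 1, 2, …`, is a run of hard thresholding pursuit with model size `s`
on the data `(X, y)`, started at `β 0`. -/
structure IsHTPRun {n p : ℕ} (X : Matrix (Fin n) (Fin p) ℝ) (y : Fin n → ℝ) (s : ℕ)
    (β : ℕ → Fin p → ℝ) (S : ℕ → Finset (Fin p)) : Prop where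
  init : S 0 = vsupp (β 0)
  threshold : ∀ t, IsTopSet s (gradStep X y (β t)) (S (t + 1))
  debias : ∀ t, IsLeastSquaresOn X y (S (t + 1)) (β (t + 1))

/-- The minimum signal strength `min_{i ∈ S} |b i|` of an estimate `b` with selected set `S`. -/
noncomputable def minSignal {p : ℕ} (S : Finset (Fin p)) (b : Fin p → ℝ) : ℝ :=
  sInf ((fun i => |b i|) '' (S : Set (Fin p)))

/-! ### Moments from the tail bound -/

section SubGaussianMoments

variable {Ω : Type*} [MeasurableSpace Ω] {μ : Measure Ω}

/-! Put `τ = σ √(2 log p / n)`, let `T` be the true support, and compare the run not with the signal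
but with the oracle fit `bhat`, the least-squares fit on `T`. Its residual correlations vanish on
`T`, so noise enters the comparison only through coordinates outside `T`.

Probability is used once, in `exists_isSeparatedFit`: outside a small event, every residual
correlation and every coordinate of `bhat` minus the signal is at most `1.97 τ`, so `bhat` is at
least `2.03 τ` on `T`. A union bound over `p` coordinates at a level just below `2 τ` needs a
variance proxy below `4 σ²`. Hence the careful exponential moment estimate giving `3.8 σ²` in
`hasSubgaussianMGF_of_tail`.

The rest is deterministic. In `htp_step_bounds` each missed coordinate is paired with a false one
that beat it in the thresholding. The gap between `2.03 τ` and `1.97 τ` has to be covered by the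
Gram defect, which the isometry property keeps small. The distance to `bhat` therefore halves at
each step, up to a floor `4 τ √(s - |T|)`. If `s = |T|` the floor is zero and the run lands exactly
on `bhat`, whose entries are large. If `s > |T|` the false coordinates have root mean square below
`2 τ`, so one of them is below `2 τ`. -/

lemma integrable_and_integral_le_of_lintegral_le {f : Ω → ℝ} {r : ℝ} (hf : Measurable f)
    (h0 : ∀ ω, 0 ≤ f ω) (hr : 0 ≤ r)
    (h : ∫⁻ ω, ENNReal.ofReal (f ω) ∂μ ≤ ENNReal.ofReal r) :
    Integrable f μ ∧ ∫ ω, f ω ∂μ ≤ r := by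
  constructor
  · refine ⟨hf.aestronglyMeasurable, ?_⟩
    rw [hasFiniteIntegral_iff_ofReal (ae_of_all _ h0)]
    exact h.trans_lt ENNReal.ofReal_lt_top
  · rw [integral_eq_lintegral_of_nonneg_ae (ae_of_all _ h0) hf.aestronglyMeasurable]
    exact ENNReal.toReal_le_of_le_ofReal hr h

lemma integrable_tsum_and_integral_le {F : ℕ → Ω → ℝ} {r : ℕ → ℝ} {s : ℝ}
    (hF : ∀ k, Measurable (F k)) (h0 : ∀ k ω, 0 ≤ F k ω) (hsum : ∀ ω, Summable fun k => F k ω)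
    (hr : ∀ k, 0 ≤ r k) (h : ∀ k, ∫⁻ ω, ENNReal.ofReal (F k ω) ∂μ ≤ ENNReal.ofReal (r k))
    (hs : HasSum r s) :
    Integrable (fun ω => ∑' k, F k ω) μ ∧ ∫ ω, ∑' k, F k ω ∂μ ≤ s := by
  have hs0 : 0 ≤ s := hs.nonneg hr
  have hmeas : Measurable fun ω => ∑' k, F k ω := by
    have : (fun ω => ∑' k, F k ω) = fun ω => (∑' k, ENNReal.ofReal (F k ω)).toReal := by
      ext ω
      rw [← ENNReal.ofReal_tsum_of_nonneg (fun k => h0 k ω) (hsum ω),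
        ENNReal.toReal_ofReal (tsum_nonneg fun k => h0 k ω)]
    rw [this]
    fun_prop
  refine integrable_and_integral_le_of_lintegral_le hmeas
    (fun ω => tsum_nonneg fun k => h0 k ω) hs0 ?_
  calc ∫⁻ ω, ENNReal.ofReal (∑' k, F k ω) ∂μ = ∫⁻ ω, ∑' k, ENNReal.ofReal (F k ω) ∂μ := by
        refine lintegral_congr fun ω => ?_
        rw [ENNReal.ofReal_tsum_of_nonneg (fun k => h0 k ω) (hsum ω)]
    _ = ∑' k, ∫⁻ ω, ENNReal.ofReal (F k ω) ∂μ :=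
        lintegral_tsum fun k => (hF k).ennreal_ofReal.aemeasurable
    _ ≤ ∑' k, ENNReal.ofReal (r k) := ENNReal.tsum_le_tsum h
    _ = ENNReal.ofReal s := by
        rw [← ENNReal.ofReal_tsum_of_nonneg hr hs.summable, hs.tsum_eq]

variable [IsProbabilityMeasure μ] {Z : Ω → ℝ}

lemma measure_lt_sq_le
    (htail : ∀ r : ℝ, 0 ≤ r → μ.real {ω | r < |Z ω|} ≤ 2 * Real.exp (-(r ^ 2) / 2))
    {t : ℝ} (ht : 0 ≤ t) :
    μ {ω | t < Z ω ^ 2} ≤ ENNReal.ofReal (2 * Real.exp (-(t / 2))) := by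
  have hset : {ω | t < Z ω ^ 2} = {ω | Real.sqrt t < |Z ω|} := by
    ext ω
    simp only [Set.mem_ofPred_eq]
    rw [Real.sqrt_lt_sqrt_iff ht |>.symm, Real.sqrt_sq_eq_abs]
  rw [hset]
  have h := htail (Real.sqrt t) (Real.sqrt_nonneg t)
  rw [Real.sq_sqrt ht] at h
  rw [← ENNReal.ofReal_toReal (measure_ne_top μ _)]
  apply ENNReal.ofReal_le_ofReal
  rwa [show -(t / 2) = -t / 2 by ring]

lemma lintegral_sq_pow_le (hZ : Measurable Z)
    (htail : ∀ r : ℝ, 0 ≤ r → μ.real {ω | r < |Z ω|} ≤ 2 * Real.exp (-(r ^ 2) / 2))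
    {k : ℕ} (hk : 0 < k) :
    ∫⁻ ω, ENNReal.ofReal ((Z ω ^ 2) ^ k) ∂μ ≤ ENNReal.ofReal (2 ^ (k + 1) * k.factorial) := by
  have hk' : (0 : ℝ) < k := by exact_mod_cast hk
  have h := lintegral_rpow_eq_lintegral_meas_lt_mul (μ := μ) (f := fun ω => Z ω ^ 2)
    (ae_of_all _ fun ω => sq_nonneg _) (by fun_prop) hk'
  simp only [Real.rpow_natCast] at h
  rw [h]
  have hgam := Real.integral_rpow_mul_exp_neg_mul_Ioi hk' (show (0 : ℝ) < 1 / 2 by norm_num)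
  have hint : IntegrableOn (fun t : ℝ => t ^ ((k : ℝ) - 1) * Real.exp (-(1 / 2 * t)))
      (Set.Ioi 0) := by
    by_contra hcon
    rw [integral_undef hcon] at hgam
    have : 0 < (1 / (1 / 2 : ℝ)) ^ (k : ℝ) * Real.Gamma k :=
      mul_pos (by positivity) (Real.Gamma_pos_of_pos hk')
    linarith
  calc ENNReal.ofReal k * ∫⁻ t in Set.Ioi (0 : ℝ), μ {a | t < Z a ^ 2} *
        ENNReal.ofReal (t ^ ((k : ℝ) - 1))
      ≤ ENNReal.ofReal k * ∫⁻ t in Set.Ioi (0 : ℝ),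
        ENNReal.ofReal (2 * (t ^ ((k : ℝ) - 1) * Real.exp (-(1 / 2 * t)))) := by
        gcongr ENNReal.ofReal k * ?_
        refine setLIntegral_mono' measurableSet_Ioi fun t ht => ?_
        have ht : 0 < t := ht
        calc _ ≤ ENNReal.ofReal (2 * Real.exp (-(t / 2))) * ENNReal.ofReal (t ^ ((k : ℝ) - 1)) := by
              gcongr
              exact measure_lt_sq_le htail ht.le
          _ = _ := by
              rw [← ENNReal.ofReal_mul (by positivity)]
              congr 1
              rw [show -(t / 2) = -(1 / 2 * t) by ring]
              ring
    _ = ENNReal.ofReal (2 ^ (k + 1) * k.factorial) := by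
        rw [← ofReal_integral_eq_lintegral_ofReal (hint.const_mul 2)
          (by
            refine (ae_restrict_iff' measurableSet_Ioi).2 (ae_of_all _ fun t ht => ?_)
            have ht : 0 < t := ht
            simp only [Pi.zero_apply]
            positivity),
          integral_const_mul, hgam, ← ENNReal.ofReal_mul hk'.le]
        congr 1
        obtain ⟨j, rfl⟩ : ∃ j, k = j + 1 := ⟨k - 1, by omega⟩
        rw [Real.rpow_natCast]
        push_cast
        rw [Real.Gamma_nat_eq_factorial, Nat.factorial_succ]
        push_cast
        norm_num
        ring

/-- Capping the tail probability by `1` up to `t = 2 log 2`, where `2 exp (-t / 2)` equals `1`,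
improves the value `4` that `lintegral_sq_pow_le` gives at exponent one. With `4` the final proxy
could not be brought below `4`. -/
lemma lintegral_sq_le (hZ : Measurable Z)
    (htail : ∀ r : ℝ, 0 ≤ r → μ.real {ω | r < |Z ω|} ≤ 2 * Real.exp (-(r ^ 2) / 2)) :
    ∫⁻ ω, ENNReal.ofReal (Z ω ^ 2) ∂μ ≤ ENNReal.ofReal (2 + 2 * Real.log 2) := by
  have hlog : 0 < Real.log 2 := Real.log_pos (by norm_num)
  rw [lintegral_eq_lintegral_meas_lt μ (ae_of_all _ fun ω => sq_nonneg _) (by fun_prop),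
    ← Set.Ioc_union_Ioi_eq_Ioi (show (0 : ℝ) ≤ 2 * Real.log 2 by positivity),
    lintegral_union measurableSet_Ioi (Set.Ioc_disjoint_Ioi le_rfl), add_comm,
    ENNReal.ofReal_add (by norm_num) (by positivity)]
  gcongr
  · have hint : IntegrableOn (fun t : ℝ => 2 * Real.exp (-(1 / 2) * t))
        (Set.Ioi (2 * Real.log 2)) :=
      (integrableOn_exp_mul_Ioi (by norm_num) _).const_mul 2
    calc _ ≤ ∫⁻ t in Set.Ioi (2 * Real.log 2), ENNReal.ofReal (2 * Real.exp (-(1 / 2) * t)) := by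
          refine setLIntegral_mono' measurableSet_Ioi fun t ht => ?_
          have ht : 2 * Real.log 2 < t := ht
          refine (measure_lt_sq_le htail (by linarith)).trans (le_of_eq ?_)
          rw [show -(t / 2) = -(1 / 2) * t by ring]
      _ = _ := by
          rw [← ofReal_integral_eq_lintegral_ofReal hint (ae_of_all _ fun t => by positivity),
            integral_const_mul, integral_exp_mul_Ioi (by norm_num)]
          congr 1
          rw [show -(1 / 2 : ℝ) * (2 * Real.log 2) = -Real.log 2 by ring, Real.exp_neg,
            Real.exp_log (by norm_num)]
          norm_num
  · calc _ ≤ ∫⁻ _ in Set.Ioc (0 : ℝ) (2 * Real.log 2), 1 := by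
          refine lintegral_mono fun t => prob_le_one
      _ = _ := by simp

end SubGaussianMoments

/-! ### Even majorants for the tail of the exponential series -/

section ExpSeries

/-- An even majorant of the terms of orders `2k+5` and `2k+6` in the exponential series. -/
noncomputable def expPairBound (k : ℕ) (x : ℝ) : ℝ :=
  1 / (2 * (2 * k + 5).factorial) * (x ^ 2) ^ (k + 2) +
    (1 / (2 * (2 * k + 5).factorial) + 1 / (2 * k + 6).factorial) * (x ^ 2) ^ (k + 3)

lemma expPairBound_nonneg (k : ℕ) (x : ℝ) : 0 ≤ expPairBound k x := by
  unfold expPairBound; positivity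

lemma summable_expPairBound (x : ℝ) : Summable fun k => expPairBound k x := by
  have h := Real.summable_pow_div_factorial |x|
  have h4 : Summable fun k : ℕ => |x| ^ (2 * k + 4) / (2 * k + 4).factorial :=
    h.comp_injective (i := fun k : ℕ => 2 * k + 4) fun a b hab => by simpa using hab
  have h6 : Summable fun k : ℕ => |x| ^ (2 * k + 6) / (2 * k + 6).factorial :=
    h.comp_injective (i := fun k : ℕ => 2 * k + 6) fun a b hab => by simpa using hab
  have h6' : Summable fun k : ℕ => |x| ^ (2 * k + 6) / (2 * k + 5).factorial := by
    have h5 : Summable fun k : ℕ => |x| ^ (2 * k + 5) / (2 * k + 5).factorial :=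
      h.comp_injective (i := fun k : ℕ => 2 * k + 5) fun a b hab => by simpa using hab
    refine (h5.mul_left |x|).congr fun k => ?_
    rw [pow_succ _ (2 * k + 5)]
    ring
  refine Summable.of_nonneg_of_le (fun k => expPairBound_nonneg k x) (fun k => ?_)
    ((h4.add h6').add h6)
  unfold expPairBound
  have e4 : |x| ^ (2 * k + 4) = (x ^ 2) ^ (k + 2) := by
    rw [← sq_abs, ← pow_mul]; ring_nf
  have e6 : |x| ^ (2 * k + 6) = (x ^ 2) ^ (k + 3) := by
    rw [← sq_abs, ← pow_mul]; ring_nf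
  rw [e4, e6, add_mul, ← add_assoc]
  have f4 : (0 : ℝ) < (2 * k + 4).factorial := by positivity
  have f5 : (0 : ℝ) < (2 * k + 5).factorial := by positivity
  have f45 : ((2 * k + 4).factorial : ℝ) ≤ (2 * k + 5).factorial := by
    exact_mod_cast Nat.factorial_le (by omega)
  gcongr ?_ + ?_ + ?_
  · rw [div_mul_eq_mul_div, one_mul]
    gcongr
    linarith
  · rw [div_mul_eq_mul_div, one_mul]
    gcongr
    linarith
  · rw [div_mul_eq_mul_div, one_mul]

lemma exp_le_quartic_add_tsum (x : ℝ) :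
    Real.exp x ≤ 1 + x + x ^ 2 / 2 + x ^ 3 / 6 + x ^ 4 / 24 + ∑' k, expPairBound k x := by
  have hexp : HasSum (fun k : ℕ => x ^ k / k.factorial) (Real.exp x) := by
    rw [Real.exp_eq_exp_ℝ]
    exact NormedSpace.expSeries_div_hasSum_exp x
  have hs := hexp.summable
  have h5 := hs.sum_add_tsum_nat_add 5
  rw [hexp.tsum_eq] at h5
  have hg : Summable fun k : ℕ => x ^ (k + 5) / (k + 5).factorial := by
    simpa using (summable_nat_add_iff 5).2 hs
  have he : Summable fun k : ℕ => x ^ (2 * k + 5) / (2 * k + 5).factorial :=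
    hg.comp_injective (i := fun k : ℕ => 2 * k) fun a b hab => by simpa using hab
  have ho : Summable fun k : ℕ => x ^ (2 * k + 1 + 5) / (2 * k + 1 + 5).factorial :=
    hg.comp_injective (i := fun k : ℕ => 2 * k + 1) fun a b hab => by simpa using hab
  have hpair := tsum_even_add_odd (f := fun k : ℕ => x ^ (k + 5) / (k + 5).factorial) he ho
  rw [← he.tsum_add ho] at hpair
  rw [← h5, ← hpair]
  have hpoly : ∑ i ∈ Finset.range 5, x ^ i / (i.factorial : ℝ) =
      1 + x + x ^ 2 / 2 + x ^ 3 / 6 + x ^ 4 / 24 := by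
    simp [Finset.sum_range_succ, Nat.factorial]
  rw [hpoly]
  refine add_le_add le_rfl ((he.add ho).tsum_le_tsum (fun k => ?_) (summable_expPairBound x))
  unfold expPairBound
  have f5 : (0 : ℝ) < (2 * k + 5).factorial := by positivity
  have key : x ^ (2 * k + 5) ≤ ((x ^ 2) ^ (k + 2) + (x ^ 2) ^ (k + 3)) / 2 := by
    -- AM-GM trades the odd power for its two even neighbours, whose moments are controlled.
    have : 0 ≤ (x ^ 2) ^ (k + 2) * (x - 1) ^ 2 := by positivity
    have e : x ^ (2 * k + 5) = (x ^ 2) ^ (k + 2) * x := by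
      rw [← pow_mul, ← pow_succ]; ring_nf
    rw [e, pow_succ _ (k + 2)]
    nlinarith
  have e6 : x ^ (2 * k + 1 + 5) = (x ^ 2) ^ (k + 3) := by rw [← pow_mul]; ring_nf
  rw [e6]
  calc _ ≤ ((x ^ 2) ^ (k + 2) + (x ^ 2) ^ (k + 3)) / 2 / (2 * k + 5).factorial +
        (x ^ 2) ^ (k + 3) / (2 * k + 1 + 5).factorial := by gcongr
    _ = _ := by field_simp; ring

/-- Together with the next lemma, this lets the integrated majorants be compared term by term with
the exponential series of `1.9 l²`. In both inductions the growth ratio is the easy part. The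
constants `0.04` and `0.5` are fitted to the base case. -/
lemma two_pow_mul_factorial_sq_le (k : ℕ) :
    2 ^ (k + 2) * ((k + 2).factorial : ℝ) ^ 2 ≤
      0.04 * 1.9 ^ (k + 2) * (2 * k + 5).factorial := by
  induction k with
  | zero => norm_num [Nat.factorial]
  | succ k ih =>
    have e : 2 * (k + 1) + 5 = (2 * k + 5) + 1 + 1 := by ring
    rw [e, Nat.factorial_succ (2 * k + 5 + 1), Nat.factorial_succ (2 * k + 5),
      show k + 1 + 2 = (k + 2) + 1 by ring, Nat.factorial_succ (k + 2), pow_succ, pow_succ]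
    push_cast
    have hk : (0 : ℝ) ≤ k := Nat.cast_nonneg k
    calc _ = (2 ^ (k + 2) * ((k + 2).factorial : ℝ) ^ 2) * (2 * (k + 3) ^ 2) := by ring
      _ ≤ (0.04 * 1.9 ^ (k + 2) * (2 * k + 5).factorial) * (1.9 * ((2 * k + 7) * (2 * k + 6))) := by
          gcongr ?_ * ?_
          nlinarith
      _ = _ := by ring

lemma two_pow_mul_factorial_sq_mul_le (k : ℕ) :
    2 ^ (k + 4) * ((k + 3).factorial : ℝ) ^ 2 * (k + 4) ≤
      0.5 * 1.9 ^ (k + 3) * (2 * k + 6).factorial := by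
  induction k with
  | zero => norm_num [Nat.factorial]
  | succ k ih =>
    have e : 2 * (k + 1) + 6 = (2 * k + 6) + 1 + 1 := by ring
    rw [e, Nat.factorial_succ (2 * k + 6 + 1), Nat.factorial_succ (2 * k + 6),
      show k + 1 + 3 = (k + 3) + 1 by ring, Nat.factorial_succ (k + 3), pow_succ _ (k + 3),
      show k + 1 + 4 = (k + 4) + 1 by ring, pow_succ _ (k + 4)]
    push_cast
    have hk : (0 : ℝ) ≤ k := Nat.cast_nonneg k
    have hk4 : (0 : ℝ) < k + 4 := by positivity
    calc _ = (2 ^ (k + 4) * ((k + 3).factorial : ℝ) ^ 2 * (k + 4)) *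
          (2 * (k + 4) * (k + 5)) := by ring
      _ ≤ (0.5 * 1.9 ^ (k + 3) * (2 * k + 6).factorial) * (1.9 * ((2 * k + 8) * (2 * k + 7))) := by
          gcongr ?_ * ?_
          nlinarith
      _ = _ := by ring

end ExpSeries

/-! ### Exponential moments with variance proxy 3.8 -/

section SubGaussianMGF

variable {Ω : Type*} [MeasurableSpace Ω] {μ : Measure Ω} [IsProbabilityMeasure μ] {Z : Ω → ℝ}

lemma lintegral_expPairBound_le (hZ : Measurable Z)
    (htail : ∀ r : ℝ, 0 ≤ r → μ.real {ω | r < |Z ω|} ≤ 2 * Real.exp (-(r ^ 2) / 2))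
    (l : ℝ) (k : ℕ) :
    ∫⁻ ω, ENNReal.ofReal (expPairBound k (l * Z ω)) ∂μ ≤
      ENNReal.ofReal (0.04 * ((1.9 * l ^ 2) ^ (k + 2) / (k + 2).factorial) +
        0.5 * ((1.9 * l ^ 2) ^ (k + 3) / (k + 3).factorial)) := by
  have f5 : (0 : ℝ) < (2 * k + 5).factorial := by positivity
  have f6 : (0 : ℝ) < (2 * k + 6).factorial := by positivity
  have e6 : ((2 * k + 6).factorial : ℝ) = (2 * k + 6) * (2 * k + 5).factorial := by
    rw [Nat.factorial_succ (2 * k + 5)]; push_cast; ring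
  have hm := fun j hj => lintegral_sq_pow_le (μ := μ) hZ htail (k := j) hj
  set a : ℝ := 1 / (2 * (2 * k + 5).factorial) * (l ^ 2) ^ (k + 2) with ha
  set b : ℝ := (1 / (2 * (2 * k + 5).factorial) + 1 / (2 * k + 6).factorial) *
    (l ^ 2) ^ (k + 3) with hb
  have ha0 : 0 ≤ a := by positivity
  have hb0 : 0 ≤ b := by positivity
  calc _ = ∫⁻ ω, (ENNReal.ofReal a * ENNReal.ofReal ((Z ω ^ 2) ^ (k + 2)) +
        ENNReal.ofReal b * ENNReal.ofReal ((Z ω ^ 2) ^ (k + 3))) ∂μ := by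
        refine lintegral_congr fun ω => ?_
        rw [← ENNReal.ofReal_mul ha0, ← ENNReal.ofReal_mul hb0,
          ← ENNReal.ofReal_add (by positivity) (by positivity)]
        congr 1
        simp only [expPairBound, ha, hb, mul_pow]
        ring
    _ = ENNReal.ofReal a * ∫⁻ ω, ENNReal.ofReal ((Z ω ^ 2) ^ (k + 2)) ∂μ +
        ENNReal.ofReal b * ∫⁻ ω, ENNReal.ofReal ((Z ω ^ 2) ^ (k + 3)) ∂μ := by
        rw [lintegral_add_left (by fun_prop), lintegral_const_mul _ (by fun_prop),
          lintegral_const_mul _ (by fun_prop)]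
    _ ≤ ENNReal.ofReal a * ENNReal.ofReal (2 ^ (k + 2 + 1) * (k + 2).factorial) +
        ENNReal.ofReal b * ENNReal.ofReal (2 ^ (k + 3 + 1) * (k + 3).factorial) := by
        gcongr
        · exact hm _ (by omega)
        · exact hm _ (by omega)
    _ ≤ _ := by
        rw [← ENNReal.ofReal_mul ha0, ← ENNReal.ofReal_mul hb0,
          ← ENNReal.ofReal_add (by positivity) (by positivity)]
        apply ENNReal.ofReal_le_ofReal
        have hA := two_pow_mul_factorial_sq_le k
        have hB := two_pow_mul_factorial_sq_mul_le k
        gcongr ?_ + ?_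
        · rw [ha, mul_pow]
          have : 2 ^ (k + 2) * ((k + 2).factorial : ℝ) / (2 * k + 5).factorial ≤
              0.04 * 1.9 ^ (k + 2) / (k + 2).factorial := by
            rw [div_le_div_iff₀ f5 (by positivity)]
            linarith
          calc _ = 2 ^ (k + 2) * ((k + 2).factorial : ℝ) / (2 * k + 5).factorial *
                (l ^ 2) ^ (k + 2) := by field_simp; ring
            _ ≤ 0.04 * 1.9 ^ (k + 2) / (k + 2).factorial * (l ^ 2) ^ (k + 2) := by gcongr
            _ = _ := by ring
        · rw [hb, mul_pow]
          have : 2 ^ (k + 4) * ((k + 3).factorial : ℝ) * (k + 4) / (2 * k + 6).factorial ≤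
              0.5 * 1.9 ^ (k + 3) / (k + 3).factorial := by
            rw [div_le_div_iff₀ f6 (by positivity)]
            linarith
          calc _ = 2 ^ (k + 4) * ((k + 3).factorial : ℝ) * (k + 4) / (2 * k + 6).factorial *
                (l ^ 2) ^ (k + 3) := by rw [e6]; field_simp; ring
            _ ≤ 0.5 * 1.9 ^ (k + 3) / (k + 3).factorial * (l ^ 2) ^ (k + 3) := by gcongr
            _ = _ := by ring

/-- The exponential moments of a centred variable with tails `2 exp (-r² / 2)`; the factor `1.9`
is close to the least possible one, half the largest variance `2 + 2 log 2`. -/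
lemma integrable_exp_and_mgf_le_of_nonneg (hZ : Measurable Z) (hmean : ∫ ω, Z ω ∂μ = 0)
    (htail : ∀ r : ℝ, 0 ≤ r → μ.real {ω | r < |Z ω|} ≤ 2 * Real.exp (-(r ^ 2) / 2))
    {l : ℝ} (hl : 0 ≤ l) :
    Integrable (fun ω => Real.exp (l * Z ω)) μ ∧ mgf Z μ l ≤ Real.exp (1.9 * l ^ 2) := by
  obtain ⟨i2, m2⟩ := integrable_and_integral_le_of_lintegral_le (f := fun ω => Z ω ^ 2)
    (by fun_prop) (fun ω => sq_nonneg _)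
    (by have := Real.log_pos (show (1 : ℝ) < 2 by norm_num); positivity)
    (lintegral_sq_le (μ := μ) hZ htail)
  obtain ⟨i4, m4⟩ := integrable_and_integral_le_of_lintegral_le (f := fun ω => (Z ω ^ 2) ^ 2)
    (by fun_prop) (fun ω => sq_nonneg _) (by positivity)
    (lintegral_sq_pow_le (μ := μ) hZ htail (k := 2) (by norm_num))
  have i1 : Integrable Z μ := by
    refine Integrable.mono' (g := fun ω => 1 + Z ω ^ 2) ((integrable_const 1).add i2)
      hZ.aestronglyMeasurable (ae_of_all _ fun ω => ?_)
    rw [Real.norm_eq_abs, ← sq_abs]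
    nlinarith [sq_nonneg (|Z ω| - 1), abs_nonneg (Z ω)]
  set x : ℝ := 1.9 * l ^ 2 with hx
  have hexp : HasSum (fun k : ℕ => x ^ k / k.factorial) (Real.exp x) := by
    rw [Real.exp_eq_exp_ℝ]
    exact NormedSpace.expSeries_div_hasSum_exp x
  have hx0 : 0 ≤ x := by positivity
  have h2 : HasSum (fun k : ℕ => x ^ (k + 2) / (k + 2).factorial) (Real.exp x - (1 + x)) := by
    have := (hasSum_nat_add_iff' 2).2 hexp
    simpa [Finset.sum_range_succ] using this
  have h3 : HasSum (fun k : ℕ => x ^ (k + 3) / (k + 3).factorial)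
      (Real.exp x - (1 + x + x ^ 2 / 2)) := by
    have := (hasSum_nat_add_iff' 3).2 hexp
    simpa [Finset.sum_range_succ] using this
  obtain ⟨iT, mT⟩ := integrable_tsum_and_integral_le (μ := μ)
    (F := fun k ω => expPairBound k (l * Z ω))
    (fun k => by unfold expPairBound; fun_prop) (fun k ω => expPairBound_nonneg _ _)
    (fun ω => summable_expPairBound _) (fun k => by positivity)
    (lintegral_expPairBound_le hZ htail l) ((h2.mul_left 0.04).add (h3.mul_left 0.5))
  set T : Ω → ℝ := fun ω => ∑' k, expPairBound k (l * Z ω) with hT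
  set G : Ω → ℝ := fun ω => (1 + l ^ 3 / 6) + (l + l ^ 3 / 3) * Z ω + l ^ 2 / 2 * Z ω ^ 2 +
    (l ^ 4 / 24 + l ^ 3 / 24) * (Z ω ^ 2) ^ 2 + T ω with hG
  have j1 : Integrable (fun ω => (1 + l ^ 3 / 6) + (l + l ^ 3 / 3) * Z ω) μ :=
    (integrable_const _).add (i1.const_mul _)
  have j2 : Integrable (fun ω => (1 + l ^ 3 / 6) + (l + l ^ 3 / 3) * Z ω +
      l ^ 2 / 2 * Z ω ^ 2) μ := j1.add (i2.const_mul _)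
  have j4 : Integrable (fun ω => (1 + l ^ 3 / 6) + (l + l ^ 3 / 3) * Z ω + l ^ 2 / 2 * Z ω ^ 2 +
      (l ^ 4 / 24 + l ^ 3 / 24) * (Z ω ^ 2) ^ 2) μ := j2.add (i4.const_mul _)
  have iG : Integrable G μ := j4.add iT
  have hle : ∀ ω, Real.exp (l * Z ω) ≤ G ω := fun ω => by
    refine (exp_le_quartic_add_tsum (l * Z ω)).trans ?_
    simp only [hG, hT]
    -- The cubic term is majorized without any `Z²`, so the sharp variance coefficient is kept; the
    -- linear part has mean zero.
    have hc : Z ω ^ 3 / 6 ≤ Z ω / 3 + ((Z ω ^ 2) ^ 2 + 4) / 24 := by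
      nlinarith [sq_nonneg (Z ω ^ 2 - 2 * Z ω - 2)]
    have := mul_le_mul_of_nonneg_left hc (pow_nonneg hl 3)
    linarith
  have iE : Integrable (fun ω => Real.exp (l * Z ω)) μ :=
    iG.mono' (by fun_prop) (ae_of_all _ fun ω => by
      rw [Real.norm_eq_abs, abs_of_pos (Real.exp_pos _)]; exact hle ω)
  refine ⟨iE, ?_⟩
  have hGint : ∫ ω, G ω ∂μ = (1 + l ^ 3 / 6) + l ^ 2 / 2 * ∫ ω, Z ω ^ 2 ∂μ +
      (l ^ 4 / 24 + l ^ 3 / 24) * ∫ ω, (Z ω ^ 2) ^ 2 ∂μ + ∫ ω, T ω ∂μ := by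
    simp only [hG]
    rw [integral_add j4 iT, integral_add j2 (i4.const_mul _), integral_add j1 (i2.const_mul _),
      integral_add (integrable_const _) (i1.const_mul _), integral_const_mul, integral_const_mul,
      integral_const_mul, hmean]
    simp
  calc mgf Z μ l ≤ ∫ ω, G ω ∂μ := integral_mono iE iG hle
    _ ≤ Real.exp x := by
      rw [hGint]
      have hlog := Real.log_two_lt_d9
      have a2 : l ^ 2 / 2 * ∫ ω, Z ω ^ 2 ∂μ ≤ l ^ 2 / 2 * 3.3864 := by
        gcongr; linarith
      have a4 : (l ^ 4 / 24 + l ^ 3 / 24) * ∫ ω, (Z ω ^ 2) ^ 2 ∂μ ≤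
          (l ^ 4 / 24 + l ^ 3 / 24) * 16 := by
        gcongr; refine m4.trans ?_; norm_num [Nat.factorial]
      have hE3 : 0 ≤ Real.exp x - (1 + x + x ^ 2 / 2) := h3.nonneg fun k => by positivity
      -- The slack of `1.9` over half the variance, about `0.2`, and the surplus in the quartic
      -- coefficient absorb the cubic cost `5/6 l³`: the quadratic has negative discriminant.
      have hq : 0 ≤ l ^ 2 * (0.2 - 5 / 6 * l + 1.05 * l ^ 2) := by
        have : 0 ≤ 0.2 - 5 / 6 * l + 1.05 * l ^ 2 := by nlinarith [sq_nonneg (l - 0.4)]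
        positivity
      have hx2 : x ^ 2 = 3.61 * l ^ 4 := by rw [hx]; ring
      rw [hx2] at mT hE3
      nlinarith

lemma hasSubgaussianMGF_of_tail (hZ : Measurable Z) (hmean : ∫ ω, Z ω ∂μ = 0)
    (htail : ∀ r : ℝ, 0 ≤ r → μ.real {ω | r < |Z ω|} ≤ 2 * Real.exp (-(r ^ 2) / 2)) :
    HasSubgaussianMGF Z 3.8 μ := by
  have key : ∀ l : ℝ, Integrable (fun ω => Real.exp (l * Z ω)) μ ∧
      mgf Z μ l ≤ Real.exp (1.9 * l ^ 2) := fun l => by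
    rcases le_total 0 l with hl | hl
    · exact integrable_exp_and_mgf_le_of_nonneg hZ hmean htail hl
    · have h := integrable_exp_and_mgf_le_of_nonneg (μ := μ) (Z := -Z) (l := -l) hZ.neg
        (by simp [integral_neg, hmean]) (by simpa using htail) (by linarith)
      simpa [mgf] using h
  refine ⟨fun l => (key l).1, fun l => (key l).2.trans (le_of_eq ?_)⟩
  congr 1
  push_cast
  ring

end SubGaussianMGF

/-! ### Basic facts on the Euclidean norm -/

section EuclideanNorm

variable {ι : Type*} [Fintype ι]

lemma l2norm_nonneg (v : ι → ℝ) : 0 ≤ l2norm v := norm_nonneg _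

lemma l2norm_sq (v : ι → ℝ) : l2norm v ^ 2 = ∑ i, v i ^ 2 := by
  simp [l2norm, EuclideanSpace.norm_sq_eq]

lemma l2norm_sq_eq_dotProduct (v : ι → ℝ) : l2norm v ^ 2 = v ⬝ᵥ v := by
  rw [l2norm_sq]
  simp [dotProduct, sq]

lemma l2norm_add_le (v w : ι → ℝ) : l2norm (v + w) ≤ l2norm v + l2norm w := by
  simpa [l2norm] using norm_add_le (WithLp.toLp 2 v : EuclideanSpace ℝ ι) (WithLp.toLp 2 w)

lemma l2norm_neg (v : ι → ℝ) : l2norm (-v) = l2norm v := by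
  simp [l2norm]

lemma l2norm_sub_rev (v w : ι → ℝ) : l2norm (v - w) = l2norm (w - v) := by
  rw [← l2norm_neg, neg_sub]

lemma l2norm_eq_zero {v : ι → ℝ} : l2norm v = 0 ↔ v = 0 := by
  simp [l2norm]

lemma abs_dotProduct_le (v w : ι → ℝ) : |v ⬝ᵥ w| ≤ l2norm v * l2norm w := by
  rw [← abs_of_nonneg (mul_nonneg (l2norm_nonneg v) (l2norm_nonneg w)), ← sq_le_sq, mul_pow,
    l2norm_sq, l2norm_sq]
  exact Finset.sum_mul_sq_le_sq_mul_sq _ _ _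

lemma abs_apply_le_l2norm (v : ι → ℝ) (i : ι) : |v i| ≤ l2norm v := by
  rw [← abs_of_nonneg (l2norm_nonneg v), ← sq_le_sq, l2norm_sq]
  exact Finset.single_le_sum (f := fun i => v i ^ 2) (fun j _ => sq_nonneg _) (Finset.mem_univ i)

end EuclideanNorm

/-! ### Tails of linear functionals of the noise -/

section NoiseTail

variable {Ω : Type*} [MeasurableSpace Ω] {μ : Measure Ω} [IsProbabilityMeasure μ]
  {n : ℕ} {ξ : Fin n → Ω → ℝ} {σ : ℝ}

lemma IsSubGaussianNoise.hasSubgaussianMGF (hξ : IsSubGaussianNoise μ ξ σ) (hσ : 0 < σ)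
    (i : Fin n) : HasSubgaussianMGF (ξ i) (⟨σ ^ 2, sq_nonneg σ⟩ * 3.8) μ := by
  have h : HasSubgaussianMGF (fun ω => ξ i ω / σ) 3.8 μ := by
    refine hasSubgaussianMGF_of_tail ((hξ.measurable i).div_const σ) ?_ fun r hr => ?_
    · rw [integral_div, hξ.mean_zero, zero_div]
    · have h := hξ.tail i (r * σ) (by positivity)
      have hset : {ω | r * σ < |ξ i ω|} = {ω | r < |ξ i ω / σ|} := by
        ext ω
        simp only [Set.mem_ofPred_eq]
        rw [abs_div, abs_of_pos hσ, lt_div_iff₀ hσ]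
      rw [hset] at h
      refine h.trans (le_of_eq ?_)
      congr 2
      field_simp
  refine (h.const_mul σ).congr (ae_of_all _ fun ω => ?_)
  simp only
  field_simp

/-- Evaluating the functional at its own coefficient vector shows that this vector has norm at most
`C`, and independence adds the proxies. Only an operator norm is needed, so the oracle fit never has
to be written with an inverse Gram matrix. -/
lemma IsSubGaussianNoise.measure_linear_ge_le (hξ : IsSubGaussianNoise μ ξ σ) (hσ : 0 < σ)
    (φ : (Fin n → ℝ) →ₗ[ℝ] ℝ) {C : ℝ} (hC : 0 < C) (hφ : ∀ v, |φ v| ≤ C * l2norm v)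
    {x : ℝ} (hx : 0 ≤ x) :
    μ.real {ω | x ≤ |φ fun i => ξ i ω|} ≤
      2 * Real.exp (-x ^ 2 / (7.6 * σ ^ 2 * C ^ 2)) := by
  set a : Fin n → ℝ := fun i => φ (Pi.single i 1) with ha
  have hφa : ∀ v, φ v = ∑ i, a i * v i := fun v => by
    conv_lhs => rw [LinearMap.pi_apply_eq_sum_univ φ v]
    refine Finset.sum_congr rfl fun i _ => ?_
    rw [smul_eq_mul, mul_comm, ha]
    congr 2
    ext j
    simp [Pi.single_apply, eq_comm]
  have hnorm : l2norm a ≤ C := by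
    have h1 := (le_abs_self _).trans (hφ a)
    rw [hφa a] at h1
    have h2 : l2norm a ^ 2 ≤ C * l2norm a := by
      rw [l2norm_sq]; simpa [sq] using h1
    rcases (l2norm_nonneg a).eq_or_lt with h0 | h0
    · rw [← h0]; exact hC.le
    · nlinarith
  have hnorm2 : ∑ i, a i ^ 2 ≤ C ^ 2 := by
    rw [← l2norm_sq]
    exact pow_le_pow_left₀ (l2norm_nonneg a) hnorm 2
  have hsub : HasSubgaussianMGF (fun ω => φ fun i => ξ i ω)
      (⟨C ^ 2 * σ ^ 2, by positivity⟩ * 3.8) μ := by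
    have h := HasSubgaussianMGF.sum_of_iIndepFun (s := Finset.univ)
      (X := fun i ω => a i * ξ i ω)
      (hξ.indep.comp (fun i x => a i * x) (fun i => by fun_prop))
      (fun i _ => (hξ.hasSubgaussianMGF hσ i).const_mul (a i))
    refine ⟨fun t => ?_, fun t => ?_⟩
    · simpa only [hφa] using h.integrable_exp_mul t
    · have := h.mgf_le t
      simp only [hφa]
      refine this.trans (Real.exp_le_exp.2 ?_)
      push_cast
      have hsum : ∑ i, a i ^ 2 * (σ ^ 2 * 3.8) ≤ C ^ 2 * σ ^ 2 * 3.8 := by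
        rw [← Finset.sum_mul]
        calc _ ≤ C ^ 2 * (σ ^ 2 * 3.8) := by gcongr
          _ = _ := by ring
      gcongr
      exact hsum
  have hc : (2 : ℝ) * ((⟨C ^ 2 * σ ^ 2, by positivity⟩ * 3.8 : NNReal) : ℝ) =
      7.6 * σ ^ 2 * C ^ 2 := by
    change 2 * ((C ^ 2 * σ ^ 2) * ((3.8 : NNReal) : ℝ)) = _
    push_cast
    ring
  have h1 := hsub.measure_ge_le hx
  have h2 := hsub.neg.measure_ge_le hx
  rw [hc] at h1 h2
  have hset : {ω | x ≤ |φ fun i => ξ i ω|} =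
      {ω | x ≤ φ fun i => ξ i ω} ∪ {ω | x ≤ (-fun ω => φ fun i => ξ i ω) ω} := by
    ext ω
    simp [le_abs]
  rw [hset, two_mul]
  exact (measureReal_union_le _ _).trans (add_le_add h1 h2)

end NoiseTail

/-! ### Restriction to a set of coordinates -/

section CoordRestrict

variable {p : ℕ}

/-- The restriction of a vector to a set of coordinates, extended by zero. -/
noncomputable def coordRestrict (A : Finset (Fin p)) (v : Fin p → ℝ) : Fin p → ℝ :=
  fun i => if i ∈ A then v i else 0

lemma coordRestrict_of_mem {A : Finset (Fin p)} {i : Fin p} (h : i ∈ A) (v : Fin p → ℝ) :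
    coordRestrict A v i = v i := if_pos h

lemma coordRestrict_of_notMem {A : Finset (Fin p)} {i : Fin p} (h : i ∉ A) (v : Fin p → ℝ) :
    coordRestrict A v i = 0 := if_neg h

lemma coordRestrict_congr {A : Finset (Fin p)} {v w : Fin p → ℝ} (h : ∀ i ∈ A, v i = w i) :
    coordRestrict A v = coordRestrict A w := by
  ext i
  by_cases hi : i ∈ A <;> simp [coordRestrict, hi, h]

lemma coordRestrict_add (A : Finset (Fin p)) (v w : Fin p → ℝ) :
    coordRestrict A (v + w) = coordRestrict A v + coordRestrict A w := by
  ext i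
  by_cases hi : i ∈ A <;> simp [coordRestrict, hi]

lemma coordRestrict_neg (A : Finset (Fin p)) (v : Fin p → ℝ) :
    coordRestrict A (-v) = -coordRestrict A v := by
  ext i
  by_cases hi : i ∈ A <;> simp [coordRestrict, hi]

lemma l2norm_coordRestrict_sq (A : Finset (Fin p)) (v : Fin p → ℝ) :
    l2norm (coordRestrict A v) ^ 2 = ∑ i ∈ A, v i ^ 2 := by
  rw [l2norm_sq]
  simp [coordRestrict, ite_pow, Finset.sum_ite_mem]

lemma l2norm_coordRestrict_le_of_abs_le {A : Finset (Fin p)} {v : Fin p → ℝ} {r : ℝ}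
    (hr : 0 ≤ r) (h : ∀ i ∈ A, |v i| ≤ r) :
    l2norm (coordRestrict A v) ≤ r * Real.sqrt A.card := by
  refine (sq_le_sq₀ (l2norm_nonneg _) (by positivity)).1 ?_
  rw [l2norm_coordRestrict_sq, mul_pow, Real.sq_sqrt (by positivity)]
  calc ∑ i ∈ A, v i ^ 2 ≤ ∑ _i ∈ A, r ^ 2 :=
        Finset.sum_le_sum fun i hi => by
          rw [← sq_abs]; exact pow_le_pow_left₀ (abs_nonneg _) (h i hi) 2
    _ = _ := by simp; ring

lemma le_l2norm_coordRestrict_of_le_abs {A : Finset (Fin p)} {v : Fin p → ℝ} {r : ℝ}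
    (hr : 0 ≤ r) (h : ∀ i ∈ A, r ≤ |v i|) :
    r * Real.sqrt A.card ≤ l2norm (coordRestrict A v) := by
  refine (sq_le_sq₀ (by positivity) (l2norm_nonneg _)).1 ?_
  rw [l2norm_coordRestrict_sq, mul_pow, Real.sq_sqrt (by positivity)]
  calc r ^ 2 * A.card = ∑ _i ∈ A, r ^ 2 := by simp; ring
    _ ≤ ∑ i ∈ A, v i ^ 2 := Finset.sum_le_sum fun i hi => by
          rw [← sq_abs (v i)]; exact pow_le_pow_left₀ hr (h i hi) 2

lemma l2norm_coordRestrict_le_of_abs_le_abs {A : Finset (Fin p)} {v w : Fin p → ℝ}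
    (h : ∀ i ∈ A, |v i| ≤ |w i|) : l2norm (coordRestrict A v) ≤ l2norm (coordRestrict A w) := by
  refine (sq_le_sq₀ (l2norm_nonneg _) (l2norm_nonneg _)).1 ?_
  rw [l2norm_coordRestrict_sq, l2norm_coordRestrict_sq]
  exact Finset.sum_le_sum fun i hi => sq_le_sq.2 (h i hi)

end CoordRestrict

/-! ### Restricted isometry and the Gram defect -/

section RestrictedIsometry

variable {n p : ℕ} {X : Matrix (Fin n) (Fin p) ℝ} {k : ℕ} {δ : ℝ}

lemma RIP.abs_inner_defect_le (hX : RIP X k δ) {A : Finset (Fin p)} (hA : A.card ≤ k)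
    {u v : Fin p → ℝ} (hu : ∀ i, i ∉ A → u i = 0) (hv : ∀ i, i ∉ A → v i = 0) :
    |n * (u ⬝ᵥ v) - (X *ᵥ u) ⬝ᵥ (X *ᵥ v)| ≤ δ * n * (l2norm u * l2norm v) := by
  have hq : ∀ z : Fin p → ℝ, (∀ i, i ∉ A → z i = 0) →
      |n * (z ⬝ᵥ z) - (X *ᵥ z) ⬝ᵥ (X *ᵥ z)| ≤ δ * n * (z ⬝ᵥ z) := fun z hz => by
    obtain ⟨h1, h2⟩ := hX.2.2 A hA z hz
    rw [l2norm_sq_eq_dotProduct, l2norm_sq_eq_dotProduct] at h1 h2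
    rw [abs_le]
    constructor <;> linarith
  rcases (l2norm_nonneg u).eq_or_lt with hu0 | hu0
  · have : u = 0 := l2norm_eq_zero.1 hu0.symm
    simp [this, l2norm_eq_zero.2]
  rcases (l2norm_nonneg v).eq_or_lt with hv0 | hv0
  · have : v = 0 := l2norm_eq_zero.1 hv0.symm
    simp [this, l2norm_eq_zero.2]
  set a := l2norm v
  set b := l2norm u
  -- Polarization after rescaling both vectors to the common norm `a * b`, which yields the product
  -- of norms on the right.
  have h1 := abs_le.1 (hq (a • u + b • v) fun i hi => by simp [hu i hi, hv i hi])
  have h2 := abs_le.1 (hq (a • u - b • v) fun i hi => by simp [hu i hi, hv i hi])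
  have hnu : u ⬝ᵥ u = b ^ 2 := (l2norm_sq_eq_dotProduct u).symm
  have hnv : v ⬝ᵥ v = a ^ 2 := (l2norm_sq_eq_dotProduct v).symm
  have hvu : v ⬝ᵥ u = u ⬝ᵥ v := dotProduct_comm _ _
  have hXvu : (X *ᵥ v) ⬝ᵥ (X *ᵥ u) = (X *ᵥ u) ⬝ᵥ (X *ᵥ v) := dotProduct_comm _ _
  simp only [Matrix.mulVec_add, Matrix.mulVec_sub, Matrix.mulVec_smul, dotProduct_add,
    dotProduct_sub, add_dotProduct, sub_dotProduct, smul_dotProduct, dotProduct_smul,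
    smul_eq_mul, hnu, hnv, hvu, hXvu] at h1 h2
  have hab : 0 < a * b := by positivity
  rw [abs_le]
  constructor
  · refine le_of_mul_le_mul_left ?_ hab
    nlinarith [h1.1, h2.2]
  · refine le_of_mul_le_mul_left ?_ hab
    nlinarith [h1.2, h2.1]

/-- The deviation `u - Xᵀ X u / n` of the normalized Gram operator from the identity. -/
noncomputable def gramDefect (X : Matrix (Fin n) (Fin p) ℝ) (u : Fin p → ℝ) : Fin p → ℝ :=
  u - (n : ℝ)⁻¹ • (Xᵀ *ᵥ (X *ᵥ u))

lemma dotProduct_transpose_mulVec (X : Matrix (Fin n) (Fin p) ℝ) (v : Fin p → ℝ)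
    (r : Fin n → ℝ) : v ⬝ᵥ (Xᵀ *ᵥ r) = (X *ᵥ v) ⬝ᵥ r := by
  rw [Matrix.dotProduct_mulVec, Matrix.vecMul_transpose]

/-- Duality: the restricted defect is paired with itself, and the bilinear bound loses one factor of
its norm. -/
lemma RIP.l2norm_coordRestrict_gramDefect_le (hn : 0 < n) (hX : RIP X k δ)
    {A B : Finset (Fin p)} (hAB : (A ∪ B).card ≤ k) {u : Fin p → ℝ}
    (hu : ∀ i, i ∉ A → u i = 0) :
    l2norm (coordRestrict B (gramDefect X u)) ≤ δ * l2norm u := by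
  have hn' : (0 : ℝ) < n := by exact_mod_cast hn
  set v := coordRestrict B (gramDefect X u) with hv
  have hvB : ∀ i, i ∉ B → v i = 0 := fun i hi => coordRestrict_of_notMem hi _
  have h := hX.abs_inner_defect_le hAB (u := v) (v := u)
    (fun i hi => hvB i fun h => hi (Finset.mem_union_right _ h))
    (fun i hi => hu i fun h => hi (Finset.mem_union_left _ h))
  have hvv : l2norm v ^ 2 = v ⬝ᵥ gramDefect X u := by
    rw [l2norm_sq_eq_dotProduct]
    refine Finset.sum_congr rfl fun i _ => ?_
    by_cases hi : i ∈ B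
    · rw [hv, coordRestrict_of_mem hi]
    · rw [hvB i hi, zero_mul, zero_mul]
  rw [gramDefect, dotProduct_sub, dotProduct_smul, dotProduct_transpose_mulVec,
    smul_eq_mul] at hvv
  have h2 : n * l2norm v ^ 2 ≤ δ * n * (l2norm v * l2norm u) := by
    rw [hvv, mul_sub, mul_inv_cancel_left₀ hn'.ne']
    exact (le_abs_self _).trans h
  rcases (l2norm_nonneg v).eq_or_lt with h0 | h0
  · rw [← h0]; exact mul_nonneg hX.1.le (l2norm_nonneg u)
  · refine le_of_mul_le_mul_left ?_ (mul_pos hn' h0)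
    nlinarith

end RestrictedIsometry

/-! ### Normal equations and the linear least-squares map -/

section LeastSquares

variable {n p : ℕ} {X : Matrix (Fin n) (Fin p) ℝ}

lemma IsLeastSquaresOn.transpose_mulVec_residual_eq_zero {y : Fin n → ℝ}
    {S : Finset (Fin p)} {b : Fin p → ℝ} (h : IsLeastSquaresOn X y S b) {i : Fin p}
    (hi : i ∈ S) : (Xᵀ *ᵥ (y - X *ᵥ b)) i = 0 := by
  set r := y - X *ᵥ b with hr
  set q := (Xᵀ *ᵥ r) i with hq
  set x := X *ᵥ Pi.single i 1 with hx
  have hxr : x ⬝ᵥ r = q := by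
    rw [hx, ← dotProduct_transpose_mulVec, single_one_dotProduct]
  set N := x ⬝ᵥ x with hN
  have hN0 : 0 ≤ N := by rw [hN, ← l2norm_sq_eq_dotProduct]; positivity
  have key : ∀ t : ℝ, 0 ≤ -2 * t * q + t ^ 2 * N := fun t => by
    have h1 := h.2 (b + t • Pi.single i 1) fun j hj => by
      have hji : j ≠ i := fun e => hj (e ▸ hi)
      simp [h.1 j hj, hji]
    have e : y - X *ᵥ (b + t • Pi.single i 1) = r - t • x := by
      rw [Matrix.mulVec_add, Matrix.mulVec_smul, hr, hx]; abel
    rw [e, ← hr] at h1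
    have h2 := pow_le_pow_left₀ (l2norm_nonneg _) h1 2
    rw [l2norm_sq_eq_dotProduct, l2norm_sq_eq_dotProduct] at h2
    simp only [dotProduct_sub, sub_dotProduct, smul_dotProduct, dotProduct_smul, smul_eq_mul,
      dotProduct_comm r x, hxr] at h2
    rw [← hN] at h2
    linarith
  -- The minimizing step would be `q / N`; the extra `1` covers a zero column and still gives a
  -- strict decrease.
  have h1 := key (q / (N + 1))
  have h2 : -2 * (q / (N + 1)) * q + (q / (N + 1)) ^ 2 * N =
      -(q ^ 2 * (N + 2) / (N + 1) ^ 2) := by field_simp; ring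
  rw [h2] at h1
  by_contra hne
  have : 0 < q ^ 2 * (N + 2) / (N + 1) ^ 2 := by positivity
  linarith

/-- The coefficients of the least-squares fit on linearly independent columns depend linearly on
the response. -/
lemma exists_linear_leastSquares {T : Finset (Fin p)}
    (hinj : ∀ u : Fin p → ℝ, (∀ i, i ∉ T → u i = 0) → X *ᵥ u = 0 → u = 0) :
    ∃ c : (Fin n → ℝ) →ₗ[ℝ] (Fin p → ℝ), (∀ v, ∀ i, i ∉ T → c v i = 0) ∧
      ∀ v, ∀ i ∈ T, (Xᵀ *ᵥ (v - X *ᵥ c v)) i = 0 := by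
  classical
  let R : (Fin p → ℝ) →ₗ[ℝ] (Fin p → ℝ) :=
    { toFun := coordRestrict T
      map_add' := coordRestrict_add T
      map_smul' := fun a v => by
        ext i
        by_cases hi : i ∈ T <;> simp [coordRestrict, hi] }
  -- The normal equations on `T`, completed by the identity off `T` to an endomorphism of the whole
  -- space, so that injectivity gives an inverse.
  let Γ : (Fin p → ℝ) →ₗ[ℝ] (Fin p → ℝ) :=
    (LinearMap.id - R) + R ∘ₗ Xᵀ.mulVecLin ∘ₗ X.mulVecLin
  have hΓmem : ∀ u, ∀ i ∈ T, Γ u i = (Xᵀ *ᵥ (X *ᵥ u)) i := fun u i hi => by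
    change (u i - coordRestrict T u i) + coordRestrict T (Xᵀ *ᵥ (X *ᵥ u)) i = _
    rw [coordRestrict_of_mem hi, coordRestrict_of_mem hi, sub_self, zero_add]
  have hΓnot : ∀ u, ∀ i, i ∉ T → Γ u i = u i := fun u i hi => by
    change (u i - coordRestrict T u i) + coordRestrict T (Xᵀ *ᵥ (X *ᵥ u)) i = _
    rw [coordRestrict_of_notMem hi, coordRestrict_of_notMem hi, sub_zero, add_zero]
  have hΓ : Function.Injective Γ := by
    rw [← LinearMap.ker_eq_bot, LinearMap.ker_eq_bot']
    intro u hu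
    have hsupp : ∀ i, i ∉ T → u i = 0 := fun i hi => by rw [← hΓnot u i hi, hu]; rfl
    refine hinj u hsupp ?_
    rw [← dotProduct_self_eq_zero, ← dotProduct_transpose_mulVec]
    refine Finset.sum_eq_zero fun i _ => ?_
    by_cases hi : i ∈ T
    · rw [← hΓmem u i hi, hu]; simp
    · rw [hsupp i hi, zero_mul]
  let e := LinearEquiv.ofInjectiveEndo Γ hΓ
  have he : ∀ v, Γ (e.symm v) = v := fun v => e.apply_symm_apply v
  refine ⟨e.symm.toLinearMap ∘ₗ R ∘ₗ Matrix.mulVecLin Xᵀ, fun v i hi => ?_, fun v i hi => ?_⟩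
  · have := hΓnot (e.symm (R (Xᵀ *ᵥ v))) i hi
    rw [he] at this
    exact this.symm.trans (coordRestrict_of_notMem hi _)
  · have := hΓmem (e.symm (R (Xᵀ *ᵥ v))) i hi
    rw [he] at this
    rw [Matrix.mulVec_sub, Pi.sub_apply, sub_eq_zero]
    exact (coordRestrict_of_mem hi _).symm.trans this

/-- Pythagoras: the fit and the residual are orthogonal. -/
lemma l2norm_fit_le_and_l2norm_residual_le {T : Finset (Fin p)} {v : Fin n → ℝ}
    {c : Fin p → ℝ} (hc : ∀ i, i ∉ T → c i = 0)
    (horth : ∀ i ∈ T, (Xᵀ *ᵥ (v - X *ᵥ c)) i = 0) :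
    l2norm (X *ᵥ c) ≤ l2norm v ∧ l2norm (v - X *ᵥ c) ≤ l2norm v := by
  have h0 : (X *ᵥ c) ⬝ᵥ (v - X *ᵥ c) = 0 := by
    rw [← dotProduct_transpose_mulVec]
    refine Finset.sum_eq_zero fun i _ => ?_
    by_cases hi : i ∈ T
    · rw [horth i hi, mul_zero]
    · rw [hc i hi, zero_mul]
  have hsum : l2norm v ^ 2 = l2norm (X *ᵥ c) ^ 2 + l2norm (v - X *ᵥ c) ^ 2 := by
    simp only [l2norm_sq_eq_dotProduct]
    simp only [dotProduct_sub, sub_dotProduct, dotProduct_comm v (X *ᵥ c)] at h0 ⊢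
    linarith
  constructor
  · exact (sq_le_sq₀ (l2norm_nonneg _) (l2norm_nonneg _)).1
      (by rw [hsum]; linarith [sq_nonneg (l2norm (v - X *ᵥ c))])
  · exact (sq_le_sq₀ (l2norm_nonneg _) (l2norm_nonneg _)).1
      (by rw [hsum]; linarith [sq_nonneg (l2norm (X *ᵥ c))])

end LeastSquares

/-! ### One step relative to the oracle fit -/

section ThresholdingStep

variable {n p : ℕ} {X : Matrix (Fin n) (Fin p) ℝ}

lemma gradStep_eq_add_gramDefect {y : Fin n → ℝ} {bhat w : Fin p → ℝ}
    (hw : (n : ℝ)⁻¹ • (Xᵀ *ᵥ (y - X *ᵥ bhat)) = w) (b : Fin p → ℝ) :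
    gradStep X y b = bhat + w + gramDefect X (b - bhat) := by
  rw [gradStep, gramDefect, ← hw]
  simp only [Matrix.mulVec_sub, smul_sub]
  abel

/-- On its own support a least-squares fit is fixed by the gradient step. -/
lemma IsLeastSquaresOn.sub_apply_eq {y : Fin n → ℝ} {bhat w b : Fin p → ℝ}
    {S : Finset (Fin p)} (hw : (n : ℝ)⁻¹ • (Xᵀ *ᵥ (y - X *ᵥ bhat)) = w)
    (h : IsLeastSquaresOn X y S b) {i : Fin p} (hi : i ∈ S) :
    (b - bhat) i = (gramDefect X (b - bhat) + w) i := by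
  have h1 := congrFun (gradStep_eq_add_gramDefect hw b) i
  have h2 := h.transpose_mulVec_residual_eq_zero hi
  simp only [gradStep, Pi.add_apply, Pi.smul_apply, smul_eq_mul, h2, mul_zero, add_zero] at h1
  simp only [Pi.sub_apply, Pi.add_apply]
  linarith

lemma sum_sq_add_comp_le {M F : Finset (Fin p)} (hdisj : Disjoint M F) {f : Fin p → Fin p}
    (hf : ∀ i ∈ M, f i ∈ F) (hinj : Set.InjOn f M) (h : Fin p → ℝ) :
    ∑ i ∈ M, (|h i| + |h (f i)|) ^ 2 ≤ 2 * l2norm (coordRestrict (M ∪ F) h) ^ 2 := by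
  classical
  rw [l2norm_coordRestrict_sq, Finset.sum_union hdisj]
  have h1 : ∑ i ∈ M, h (f i) ^ 2 ≤ ∑ j ∈ F, h j ^ 2 := by
    rw [← Finset.sum_image (f := fun j => h j ^ 2) hinj]
    exact Finset.sum_le_sum_of_subset_of_nonneg
      (fun j hj => by obtain ⟨i, hi, rfl⟩ := Finset.mem_image.1 hj; exact hf i hi)
      fun j _ _ => sq_nonneg _
  have h2 : ∑ i ∈ M, (|h i| + |h (f i)|) ^ 2 ≤ ∑ i ∈ M, 2 * (h i ^ 2 + h (f i) ^ 2) :=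
    Finset.sum_le_sum fun i _ => by
      rw [← sq_abs (h i), ← sq_abs (h (f i))]
      nlinarith [sq_nonneg (|h i| - |h (f i)|)]
  rw [← Finset.mul_sum, Finset.sum_add_distrib] at h2
  linarith

lemma exists_injOn_mapsTo_of_card_le {M F : Finset (Fin p)} (h : M.card ≤ F.card) :
    ∃ f : Fin p → Fin p, (∀ i ∈ M, f i ∈ F) ∧ Set.InjOn f M := by
  classical
  obtain ⟨F', hF', hcard⟩ := Finset.exists_subset_card_eq h
  let e := Finset.equivOfCardEq hcard.symm
  refine ⟨fun i => if hi : i ∈ M then (e ⟨i, hi⟩ : Fin p) else i, fun i hi => ?_,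
    fun i hi j hj hij => ?_⟩
  · simp only [hi, dif_pos]
    exact hF' (e ⟨i, hi⟩).2
  · have hi : i ∈ M := hi
    have hj : j ∈ M := hj
    simp only [hi, hj, dif_pos] at hij
    simpa using e.injective (Subtype.ext hij)

/-- One step of hard thresholding pursuit, measured against a least-squares fit `bhat` on the
columns in `T` whose residual has correlations `w` with the columns. -/
lemma htp_step_bounds (hn : 0 < n) {s : ℕ} {δ : ℝ} (hX : RIP X (3 * s) δ)
    {y : Fin n → ℝ} {T : Finset (Fin p)} (hT : T.card ≤ s) {bhat w : Fin p → ℝ}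
    (hbT : ∀ i, i ∉ T → bhat i = 0) (hw : (n : ℝ)⁻¹ • (Xᵀ *ᵥ (y - X *ᵥ bhat)) = w)
    (hwT : ∀ i ∈ T, w i = 0) {τ : ℝ} (hτ : 0 ≤ τ) (hbig : ∀ i ∈ T, 2.03 * τ ≤ |bhat i|)
    (hws : ∀ j, |w j| ≤ 1.97 * τ) {b b' : Fin p → ℝ} {A S : Finset (Fin p)}
    (hb : ∀ i, i ∉ A → b i = 0) (hA : A.card ≤ s) (hS : IsTopSet s (gradStep X y b) S)
    (hb' : IsLeastSquaresOn X y S b') :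
    0.06 * τ * Real.sqrt (T \ S).card ≤ Real.sqrt 2 * δ * l2norm (b - bhat) ∧
      l2norm (coordRestrict (T \ S) bhat) ≤
        1.97 * τ * Real.sqrt (T \ S).card + Real.sqrt 2 * δ * l2norm (b - bhat) ∧
      (1 - δ) * l2norm (b' - bhat) ≤
        l2norm (coordRestrict (T \ S) bhat) + 1.97 * τ * Real.sqrt (S \ T).card ∧
      l2norm (coordRestrict (S \ T) b') ≤
        δ * l2norm (b' - bhat) + 1.97 * τ * Real.sqrt (S \ T).card ∧
      (T \ S).card + s = (S \ T).card + T.card := by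
  classical
  have hScard : S.card = s := hS.1
  have hcard : (T \ S).card + s = (S \ T).card + T.card := by
    have h1 := Finset.card_sdiff_add_card_inter T S
    have h2 := Finset.card_sdiff_add_card_inter S T
    rw [Finset.inter_comm] at h2
    omega
  obtain ⟨f, hfF, hfinj⟩ := exists_injOn_mapsTo_of_card_le
    (show (T \ S).card ≤ (S \ T).card by omega)
  set M := T \ S with hM
  set F := S \ T with hF
  set d := b - bhat with hd
  set d' := b' - bhat with hd'
  have hdsupp : ∀ i, i ∉ A ∪ T → d i = 0 := fun i hi => by
    simp only [Finset.mem_union, not_or] at hi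
    simp [hd, hb i hi.1, hbT i hi.2]
  have hd'supp : ∀ i, i ∉ S ∪ T → d' i = 0 := fun i hi => by
    simp only [Finset.mem_union, not_or] at hi
    simp [hd', hb'.1 i hi.1, hbT i hi.2]
  have hdisj : Disjoint M F := Finset.disjoint_left.2 fun i hi hi' =>
    (Finset.mem_sdiff.1 hi).2 (Finset.mem_sdiff.1 hi').1
  set h := gramDefect X d with hh
  set g : Fin p → ℝ := fun i => |h i| + |h (f i)| with hg
  have hg0 : ∀ i, 0 ≤ g i := fun i => by positivity
  have hδ0 : 0 ≤ δ := hX.1.le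
  -- This is where order `3 * s` is needed: the old support, `T` and the new support are all
  -- involved.
  have hMF : l2norm (coordRestrict (M ∪ F) h) ≤ δ * l2norm d := by
    refine hX.l2norm_coordRestrict_gramDefect_le hn ?_ hdsupp
    have hsub : (A ∪ T) ∪ (M ∪ F) ⊆ (A ∪ T) ∪ S := by
      intro i
      simp only [hM, hF, Finset.mem_union, Finset.mem_sdiff]
      tauto
    refine (Finset.card_le_card hsub).trans ((Finset.card_union_le _ _).trans ?_)
    have := Finset.card_union_le A T
    omega
  have hgM : l2norm (coordRestrict M g) ≤ Real.sqrt 2 * δ * l2norm d := by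
    refine (sq_le_sq₀ (l2norm_nonneg _)
      (by have := l2norm_nonneg d; positivity)).1 ?_
    rw [l2norm_coordRestrict_sq, mul_assoc, mul_pow, Real.sq_sqrt (by norm_num)]
    refine (sum_sq_add_comp_le hdisj hfF hfinj h).trans ?_
    have := pow_le_pow_left₀ (l2norm_nonneg _) hMF 2
    linarith
  -- Thresholding preferred `f i` to `i`. At `i` the gradient step is signal plus defect, at `f i`
  -- noise plus defect.
  have hpair : ∀ i ∈ M, |bhat i| ≤ 1.97 * τ + g i := fun i hi => by
    have hiT : i ∈ T := (Finset.mem_sdiff.1 hi).1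
    have hiS : i ∉ S := (Finset.mem_sdiff.1 hi).2
    have hjS : f i ∈ S := (Finset.mem_sdiff.1 (hfF i hi)).1
    have hjT : f i ∉ T := (Finset.mem_sdiff.1 (hfF i hi)).2
    have htop := hS.2 (f i) hjS i hiS
    rw [gradStep_eq_add_gramDefect hw b, ← hd, ← hh] at htop
    simp only [Pi.add_apply, hwT i hiT, hbT _ hjT, add_zero, zero_add] at htop
    have h1 : |bhat i| ≤ |bhat i + h i| + |h i| := by
      have := abs_sub (bhat i + h i) (h i)
      rwa [add_sub_cancel_right] at this
    have h2 := abs_add_le (w (f i)) (h (f i))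
    have h3 := hws (f i)
    simp only [hg]
    linarith
  refine ⟨?_, ?_, ?_, ?_, hcard⟩
  · refine le_trans ?_ hgM
    refine le_l2norm_coordRestrict_of_le_abs (by positivity) fun i hi => ?_
    rw [abs_of_nonneg (hg0 i)]
    have h1 := hbig i (Finset.mem_sdiff.1 hi).1
    have h2 := hpair i hi
    linarith
  · have h1 : l2norm (coordRestrict M bhat) ≤
        l2norm (coordRestrict M ((fun _ => 1.97 * τ) + g)) :=
      l2norm_coordRestrict_le_of_abs_le_abs fun i hi => by
        have h0 := hg0 i
        rw [Pi.add_apply, abs_of_nonneg (a := 1.97 * τ + g i) (by positivity)]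
        exact hpair i hi
    rw [coordRestrict_add] at h1
    have h2 := l2norm_add_le (coordRestrict M fun _ => 1.97 * τ) (coordRestrict M g)
    have h3 := l2norm_coordRestrict_le_of_abs_le (A := M) (v := fun _ => 1.97 * τ)
      (r := 1.97 * τ) (by positivity) fun i _ => (abs_of_nonneg (by positivity)).le
    linarith
  -- The new error is the lost signal on `M`, a defect on `S` that is a small multiple of the error
  -- itself, and noise on the false coordinates only.
  · have hsplit : d' = coordRestrict M (-bhat) + (coordRestrict S (gramDefect X d') +
        coordRestrict F w) := by
      ext i
      simp only [Pi.add_apply]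
      by_cases hiS : i ∈ S
      · have hiM : i ∉ M := fun h => (Finset.mem_sdiff.1 h).2 hiS
        rw [coordRestrict_of_notMem hiM, coordRestrict_of_mem hiS,
          show d' i = gramDefect X d' i + w i from hb'.sub_apply_eq hw hiS, zero_add]
        by_cases hiT : i ∈ T
        · have hiF : i ∉ F := fun h => (Finset.mem_sdiff.1 h).2 hiT
          rw [coordRestrict_of_notMem hiF, hwT i hiT]
        · rw [coordRestrict_of_mem (Finset.mem_sdiff.2 ⟨hiS, hiT⟩)]
      · have hiF : i ∉ F := fun h => hiS (Finset.mem_sdiff.1 h).1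
        rw [coordRestrict_of_notMem hiS, coordRestrict_of_notMem hiF]
        by_cases hiT : i ∈ T
        · rw [coordRestrict_of_mem (Finset.mem_sdiff.2 ⟨hiT, hiS⟩)]
          simp [hd', hb'.1 i hiS]
        · rw [coordRestrict_of_notMem fun h => hiT (Finset.mem_sdiff.1 h).1]
          simp [hd', hb'.1 i hiS, hbT i hiT]
    have hSd : l2norm (coordRestrict S (gramDefect X d')) ≤ δ * l2norm d' := by
      refine hX.l2norm_coordRestrict_gramDefect_le hn ?_ hd'supp
      have hsub : (S ∪ T) ∪ S ⊆ S ∪ T := by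
        intro i
        simp only [Finset.mem_union]
        tauto
      refine (Finset.card_le_card hsub).trans ((Finset.card_union_le _ _).trans ?_)
      omega
    have hwF : l2norm (coordRestrict F w) ≤ 1.97 * τ * Real.sqrt F.card :=
      l2norm_coordRestrict_le_of_abs_le (by positivity) fun i _ => hws i
    have h1 := congrArg l2norm hsplit
    have h2 := l2norm_add_le (coordRestrict M (-bhat)) (coordRestrict S (gramDefect X d') +
        coordRestrict F w)
    have h3 := l2norm_add_le (coordRestrict S (gramDefect X d')) (coordRestrict F w)
    rw [coordRestrict_neg, l2norm_neg] at h2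
    rw [coordRestrict_neg] at h1
    linarith
  · have e : coordRestrict F b' = coordRestrict F (gramDefect X d') + coordRestrict F w := by
      rw [← coordRestrict_add]
      refine coordRestrict_congr fun i hi => ?_
      rw [← hb'.sub_apply_eq hw (Finset.mem_sdiff.1 hi).1, Pi.sub_apply,
        hbT i (Finset.mem_sdiff.1 hi).2, sub_zero]
    have hFd : l2norm (coordRestrict F (gramDefect X d')) ≤ δ * l2norm d' := by
      refine hX.l2norm_coordRestrict_gramDefect_le hn ?_ hd'supp
      have hsub : (S ∪ T) ∪ F ⊆ S ∪ T := by
        intro i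
        simp only [hF, Finset.mem_union, Finset.mem_sdiff]
        tauto
      refine (Finset.card_le_card hsub).trans ((Finset.card_union_le _ _).trans ?_)
      omega
    have hwF : l2norm (coordRestrict F w) ≤ 1.97 * τ * Real.sqrt F.card :=
      l2norm_coordRestrict_le_of_abs_le (by positivity) fun i _ => hws i
    rw [e]
    have h3 := l2norm_add_le (coordRestrict F (gramDefect X d')) (coordRestrict F w)
    linarith

end ThresholdingStep

/-! ### Convergence of the run on the good event -/

section Run

variable {n p : ℕ} {X : Matrix (Fin n) (Fin p) ℝ}

/-- `bhat` satisfies the normal equations on the columns in `T`, has large coefficients there, and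
its residual is nearly uncorrelated with every column, all on the scale `τ`. -/
structure IsSeparatedFit (X : Matrix (Fin n) (Fin p) ℝ) (y : Fin n → ℝ) (T : Finset (Fin p))
    (bhat : Fin p → ℝ) (τ : ℝ) : Prop where
  supp : ∀ i, i ∉ T → bhat i = 0
  normal : ∀ i ∈ T, (Xᵀ *ᵥ (y - X *ᵥ bhat)) i = 0
  large : ∀ i ∈ T, 2.03 * τ ≤ |bhat i|
  corr : ∀ j, |(n : ℝ)⁻¹ * (Xᵀ *ᵥ (y - X *ᵥ bhat)) j| ≤ 1.97 * τ

variable {s : ℕ} {δ : ℝ} {y : Fin n → ℝ} {T : Finset (Fin p)} {bhat : Fin p → ℝ} {τ : ℝ}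
  {β : ℕ → Fin p → ℝ} {S : ℕ → Finset (Fin p)}

lemma IsHTPRun.eq_zero_of_notMem (h : IsHTPRun X y s β S) (t : ℕ) {i : Fin p} (hi : i ∉ S t) :
    β t i = 0 := by
  cases t with
  | zero =>
    rw [h.init] at hi
    simpa [vsupp] using hi
  | succ t => exact (h.debias t).1 i hi

lemma IsHTPRun.card_le (h : IsHTPRun X y s β S) (h0 : (vsupp (β 0)).card ≤ s) (t : ℕ) :
    (S t).card ≤ s := by
  cases t with
  | zero => rw [h.init]; exact h0
  | succ t => exact (h.threshold t).1.le

lemma IsHTPRun.step_bounds (hn : 0 < n) (hX : RIP X (3 * s) δ) (hδ : δ < 0.005)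
    (hT : T.card ≤ s) (hτ : 0 ≤ τ) (hfit : IsSeparatedFit X y T bhat τ)
    (h : IsHTPRun X y s β S) (h0 : (vsupp (β 0)).card ≤ s) (t : ℕ) :
    0.06 * τ * Real.sqrt (T \ S (t + 1)).card ≤ 0.0071 * l2norm (β t - bhat) ∧
      l2norm (coordRestrict (T \ S (t + 1)) bhat) ≤
        1.97 * τ * Real.sqrt (T \ S (t + 1)).card + 0.0071 * l2norm (β t - bhat) ∧
      0.995 * l2norm (β (t + 1) - bhat) ≤
        l2norm (coordRestrict (T \ S (t + 1)) bhat) +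
          1.97 * τ * Real.sqrt (S (t + 1) \ T).card ∧
      l2norm (coordRestrict (S (t + 1) \ T) (β (t + 1))) ≤
        0.005 * l2norm (β (t + 1) - bhat) + 1.97 * τ * Real.sqrt (S (t + 1) \ T).card ∧
      (T \ S (t + 1)).card + s = (S (t + 1) \ T).card + T.card := by
  obtain ⟨h1, h2, h3, h4, h5⟩ := htp_step_bounds hn hX hT hfit.supp rfl
    (fun i hi => by simp [hfit.normal i hi]) hτ hfit.large
    (fun j => by simpa using hfit.corr j)
    (fun i hi => h.eq_zero_of_notMem t hi) (h.card_le h0 t) (h.threshold t) (h.debias t)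
  have hd := l2norm_nonneg (β t - bhat)
  have hd' := l2norm_nonneg (β (t + 1) - bhat)
  have hδ0 := hX.1
  have hs2 : Real.sqrt 2 ≤ 1.42 := by
    rw [Real.sqrt_le_left (by norm_num)]; norm_num
  have hq : Real.sqrt 2 * δ * l2norm (β t - bhat) ≤ 0.0071 * l2norm (β t - bhat) := by
    gcongr
    calc Real.sqrt 2 * δ ≤ 1.42 * 0.005 := by gcongr
      _ = 0.0071 := by norm_num
  refine ⟨h1.trans hq, h2.trans (by linarith), ?_, ?_, h5⟩
  · nlinarith
  · nlinarith

/-- With `m` missed coordinates there are `s - |T| + m` false ones. The first step bound gives `τ √m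
≤ (0.0071 / 0.06) d` for the old distance `d`, so the old error enters with factor about `0.476`,
below one half. The remaining term is below `2 τ √(s - |T|)`, consistent with the floor `4`. -/
lemma IsHTPRun.l2norm_sub_le (hn : 0 < n) (hX : RIP X (3 * s) δ) (hδ : δ < 0.005)
    (hT : T.card ≤ s) (hτ : 0 ≤ τ) (hfit : IsSeparatedFit X y T bhat τ)
    (h : IsHTPRun X y s β S) (h0 : (vsupp (β 0)).card ≤ s) (t : ℕ) :
    l2norm (β t - bhat) ≤
      l2norm (β 0 - bhat) / 2 ^ t + 4 * τ * Real.sqrt ((s - T.card : ℕ) : ℝ) := by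
  induction t with
  | zero =>
    have : 0 ≤ 4 * τ * Real.sqrt ((s - T.card : ℕ) : ℝ) := by positivity
    simpa using this
  | succ t ih =>
    obtain ⟨h1, h2, h3, -, h5⟩ := h.step_bounds hn hX hδ hT hτ hfit h0 t
    have hk : (S (t + 1) \ T).card = (s - T.card) + (T \ S (t + 1)).card := by omega
    have hsq : Real.sqrt (S (t + 1) \ T).card ≤
        Real.sqrt ((s - T.card : ℕ) : ℝ) + Real.sqrt (T \ S (t + 1)).card := by
      rw [hk]
      push_cast
      rw [Real.sqrt_le_left (by positivity), add_sq, Real.sq_sqrt (by positivity),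
        Real.sq_sqrt (by positivity)]
      have : 0 ≤ 2 * Real.sqrt ((s - T.card : ℕ) : ℝ) * Real.sqrt (T \ S (t + 1)).card := by
        positivity
      linarith
    have hsq' := mul_le_mul_of_nonneg_left hsq hτ
    rw [pow_succ, ← div_div]
    have hd := l2norm_nonneg (β t - bhat)
    have hk0 : 0 ≤ τ * Real.sqrt ((s - T.card : ℕ) : ℝ) := by positivity
    linarith

/-- Once the distance is at most `8 τ`, the first step bound reads `0.06 √m ≤ 0.0568`, so the
integer `m` of missed coordinates is zero. Then nothing false is selected either, and the error
bound has right-hand side zero. -/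
lemma IsHTPRun.eq_of_card_eq (hn : 0 < n) (hX : RIP X (3 * s) δ) (hδ : δ < 0.005)
    (hT : T.card = s) (hτ : 0 < τ) (hfit : IsSeparatedFit X y T bhat τ)
    (h : IsHTPRun X y s β S) (h0 : (vsupp (β 0)).card ≤ s) {t : ℕ}
    (ht : l2norm (β 0 - bhat) / 2 ^ t ≤ 8 * τ) :
    S (t + 1) = T ∧ β (t + 1) = bhat := by
  obtain ⟨h1, -, h3, -, h5⟩ := h.step_bounds hn hX hδ hT.le hτ.le hfit h0 t
  have hle := h.l2norm_sub_le hn hX hδ hT.le hτ.le hfit h0 t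
  simp only [hT, tsub_self, Nat.cast_zero, Real.sqrt_zero, mul_zero, add_zero] at hle
  have hM : (T \ S (t + 1)).card = 0 := by
    by_contra hne
    have : (1 : ℝ) ≤ Real.sqrt (T \ S (t + 1)).card := by
      rw [Real.one_le_sqrt]
      exact_mod_cast Nat.one_le_iff_ne_zero.2 hne
    nlinarith
  have hF : (S (t + 1) \ T).card = 0 := by omega
  have hTS : T ⊆ S (t + 1) := Finset.sdiff_eq_empty_iff_subset.1 (Finset.card_eq_zero.1 hM)
  have hST : S (t + 1) ⊆ T := Finset.sdiff_eq_empty_iff_subset.1 (Finset.card_eq_zero.1 hF)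
  refine ⟨hST.antisymm hTS, ?_⟩
  have hz : l2norm (coordRestrict (T \ S (t + 1)) bhat) = 0 := by
    rw [Finset.card_eq_zero.1 hM, l2norm_eq_zero]
    ext i
    simp [coordRestrict]
  rw [hz, hF] at h3
  simp only [Nat.cast_zero, Real.sqrt_zero, mul_zero, add_zero] at h3
  have hd' := l2norm_nonneg (β (t + 1) - bhat)
  exact sub_eq_zero.1 (l2norm_eq_zero.1 (le_antisymm (by linarith) hd'))

/-- With `f ≥ 1` false coordinates the previous distance is at most `12 τ √f`. The step bounds then
put the norm on the false coordinates at about `1.991 τ √f`, below `2 τ √f`, so they cannot all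
reach `2 τ`. -/
lemma IsHTPRun.minSignal_lt (hn : 0 < n) (hX : RIP X (3 * s) δ) (hδ : δ < 0.005)
    (hT : T.card < s) (hτ : 0 < τ) (hfit : IsSeparatedFit X y T bhat τ)
    (h : IsHTPRun X y s β S) (h0 : (vsupp (β 0)).card ≤ s) {t : ℕ}
    (ht : l2norm (β 0 - bhat) / 2 ^ t ≤ 8 * τ) :
    minSignal (S (t + 1)) (β (t + 1)) < 2 * τ := by
  obtain ⟨-, h2, h3, h4, h5⟩ := h.step_bounds hn hX hδ hT.le hτ.le hfit h0 t
  have hle := h.l2norm_sub_le hn hX hδ hT.le hτ.le hfit h0 t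
  have hk0 : (1 : ℝ) ≤ Real.sqrt ((s - T.card : ℕ) : ℝ) := by
    rw [Real.one_le_sqrt]
    exact_mod_cast (show 1 ≤ s - T.card by omega)
  have hk : Real.sqrt ((s - T.card : ℕ) : ℝ) ≤ Real.sqrt (S (t + 1) \ T).card :=
    Real.sqrt_le_sqrt (by exact_mod_cast (show s - T.card ≤ (S (t + 1) \ T).card by omega))
  have hm : Real.sqrt (T \ S (t + 1)).card ≤ Real.sqrt (S (t + 1) \ T).card :=
    Real.sqrt_le_sqrt (by exact_mod_cast (show (T \ S (t + 1)).card ≤ (S (t + 1) \ T).card by omega))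
  have hk0' := mul_le_mul_of_nonneg_left (hk0.trans hk) hτ.le
  have hk' := mul_le_mul_of_nonneg_left hk hτ.le
  have hm' := mul_le_mul_of_nonneg_left hm hτ.le
  have hlt : l2norm (coordRestrict (S (t + 1) \ T) (β (t + 1))) <
      2 * τ * Real.sqrt (S (t + 1) \ T).card := by linarith
  obtain ⟨j, hj, hjlt⟩ : ∃ j ∈ S (t + 1) \ T, |β (t + 1) j| < 2 * τ := by
    by_contra! hcon
    have := le_l2norm_coordRestrict_of_le_abs (by positivity) hcon
    linarith
  have hbdd : BddBelow ((fun i => |β (t + 1) i|) '' (S (t + 1) : Set (Fin p))) :=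
    ⟨0, by rintro _ ⟨i, -, rfl⟩; exact abs_nonneg _⟩
  exact (csInf_le hbdd ⟨j, (Finset.mem_sdiff.1 hj).1, rfl⟩).trans_lt hjlt

end Run

/-! ### The oracle fit is separated with high probability -/

section OracleFit

variable {Ω : Type*} [MeasurableSpace Ω] {μ : Measure Ω} [IsProbabilityMeasure μ]
  {n p : ℕ} {X : Matrix (Fin n) (Fin p) ℝ} {ξ : Fin n → Ω → ℝ} {σ : ℝ}

/-- The least-squares fit on the true support is, off an event of small probability, within
`1.97 τ` of the signal and leaves a residual nearly uncorrelated with every column. -/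
lemma exists_isSeparatedFit (hn : 0 < n) (hp : 1 < p)
    (hcol : ∀ j, l2norm (fun i => X i j) = Real.sqrt n) {k : ℕ} {δ : ℝ} (hX : RIP X k δ)
    (hδ : δ < 0.005) (hσ : 0 < σ) (hξ : IsSubGaussianNoise μ ξ σ) {βstar : Fin p → ℝ}
    (hk : (vsupp βstar).card ≤ k) {τ : ℝ} (hτ : τ = σ * Real.sqrt (2 * Real.log p / n))
    (hlarge : ∀ i ∈ vsupp βstar, 4 * τ ≤ |βstar i|) :
    ∃ bhat : Ω → Fin p → ℝ, μ.real {ω | ¬(IsSeparatedFit X (X *ᵥ βstar + fun i => ξ i ω)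
        (vsupp βstar) (bhat ω) τ ∧ ∀ i, |bhat ω i - βstar i| ≤ 1.97 * τ)} ≤
      4 * p * Real.exp (-1.016 * Real.log p) := by
  have hn' : (0 : ℝ) < n := by exact_mod_cast hn
  have hlog : 0 < Real.log p := Real.log_pos (by exact_mod_cast hp)
  set T := vsupp βstar with hTdef
  have hsupp : ∀ i, i ∉ T → βstar i = 0 := fun i hi => by simpa [hTdef, vsupp] using hi
  have hlow : ∀ u : Fin p → ℝ, (∀ i, i ∉ T → u i = 0) →
      0.995 * n * l2norm u ^ 2 ≤ l2norm (X *ᵥ u) ^ 2 := fun u hu => by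
    refine le_trans ?_ (hX.2.2 T hk u hu).1
    rw [← mul_assoc]
    gcongr
    linarith
  obtain ⟨c, hcT, hcorth⟩ := exists_linear_leastSquares (X := X) (T := T) fun u hu hXu => by
    have h := hlow u hu
    rw [hXu, l2norm_eq_zero.2 rfl] at h
    have : l2norm u ^ 2 ≤ 0 := by
      by_contra! hpos
      have : 0 < 0.995 * n * l2norm u ^ 2 := by positivity
      norm_num at h
      linarith
    exact l2norm_eq_zero.1 (pow_eq_zero_iff (two_ne_zero) |>.1 (le_antisymm this (sq_nonneg _)))
  -- A common operator norm for both families of functionals: the isometry bound gives it for fitted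
  -- coefficients, and column norm `√n` gives the slightly smaller `1 / √n` for residual
  -- correlations.
  set C : ℝ := (Real.sqrt (0.995 * n))⁻¹ with hC
  have hC0 : 0 < C := by positivity
  have hC2 : C ^ 2 = (0.995 * (n : ℝ))⁻¹ := by rw [hC, inv_pow, Real.sq_sqrt (by positivity)]
  let W : (Fin n → ℝ) →ₗ[ℝ] (Fin p → ℝ) :=
    (n : ℝ)⁻¹ • (Xᵀ.mulVecLin ∘ₗ (LinearMap.id - X.mulVecLin ∘ₗ c))
  have hW : ∀ v j, W v j = (n : ℝ)⁻¹ * (Xᵀ *ᵥ (v - X *ᵥ c v)) j := fun v j => rfl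
  have hcle : ∀ i v, |(LinearMap.proj i ∘ₗ c : (Fin n → ℝ) →ₗ[ℝ] ℝ) v| ≤ C * l2norm v := by
    intro i v
    have h1 := hlow (c v) (hcT v)
    have h2 := (l2norm_fit_le_and_l2norm_residual_le (hcT v) (hcorth v)).1
    refine (abs_apply_le_l2norm (c v) i).trans ?_
    refine (sq_le_sq₀ (l2norm_nonneg _) (mul_nonneg hC0.le (l2norm_nonneg _))).1 ?_
    rw [mul_pow, hC2, inv_mul_eq_div, le_div_iff₀ (by positivity)]
    have h3 := pow_le_pow_left₀ (l2norm_nonneg _) h2 2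
    linarith
  have hWle : ∀ j v, |(LinearMap.proj j ∘ₗ W : (Fin n → ℝ) →ₗ[ℝ] ℝ) v| ≤ C * l2norm v := by
    intro j v
    have h2 := (l2norm_fit_le_and_l2norm_residual_le (hcT v) (hcorth v)).2
    have h3 : |(Xᵀ *ᵥ (v - X *ᵥ c v)) j| ≤ Real.sqrt n * l2norm (v - X *ᵥ c v) := by
      rw [← hcol j]
      exact abs_dotProduct_le (fun i => X i j) (v - X *ᵥ c v)
    change |W v j| ≤ _
    rw [hW, abs_mul, abs_of_pos (inv_pos.2 hn')]
    have hsn : (n : ℝ)⁻¹ * Real.sqrt n ≤ C := by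
      rw [hC, inv_mul_eq_div, Real.sqrt_div_self]
      gcongr
      linarith
    calc (n : ℝ)⁻¹ * |(Xᵀ *ᵥ (v - X *ᵥ c v)) j|
        ≤ (n : ℝ)⁻¹ * (Real.sqrt n * l2norm v) := by
          gcongr
          exact h3.trans (by gcongr)
      _ = (n : ℝ)⁻¹ * Real.sqrt n * l2norm v := by ring
      _ ≤ C * l2norm v := by
          gcongr
          exact l2norm_nonneg v
  have hτ0 : 0 ≤ τ := by rw [hτ]; positivity
  have htail : ∀ φ : (Fin n → ℝ) →ₗ[ℝ] ℝ, (∀ v, |φ v| ≤ C * l2norm v) →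
      μ.real {ω | 1.97 * τ ≤ |φ fun i => ξ i ω|} ≤ 2 * Real.exp (-1.016 * Real.log p) := by
    intro φ hφ
    refine (hξ.measure_linear_ge_le hσ φ hC0 hφ (by positivity)).trans ?_
    gcongr
    rw [hτ, hC2]
    -- The coefficient is about `1.0162`; exceeding `1` is what makes the union bound over `p`
    -- coordinates possible.
    have e : -(1.97 * (σ * Real.sqrt (2 * Real.log p / n))) ^ 2 /
        (7.6 * σ ^ 2 * (0.995 * (n : ℝ))⁻¹) = -(1.97 ^ 2 * 2 * 0.995 / 7.6) * Real.log p := by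
      rw [mul_pow, mul_pow, Real.sq_sqrt (by positivity)]
      field_simp
    rw [e]
    gcongr
    norm_num
  refine ⟨fun ω => βstar + c fun i => ξ i ω, ?_⟩
  have hsub : {ω | ¬(IsSeparatedFit X (X *ᵥ βstar + fun i => ξ i ω) T
        (βstar + c fun i => ξ i ω) τ ∧
        ∀ i, |(βstar + c fun i => ξ i ω) i - βstar i| ≤ 1.97 * τ)} ⊆
      (⋃ j, {ω | 1.97 * τ ≤ |(LinearMap.proj j ∘ₗ W : (Fin n → ℝ) →ₗ[ℝ] ℝ) fun i => ξ i ω|}) ∪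
      ⋃ j, {ω | 1.97 * τ ≤ |(LinearMap.proj j ∘ₗ c : (Fin n → ℝ) →ₗ[ℝ] ℝ) fun i => ξ i ω|} := by
    intro ω hω
    by_contra hcon
    simp only [Set.mem_union, Set.mem_iUnion, Set.mem_ofPred_eq, not_or, not_exists, not_le]
      at hcon
    obtain ⟨hw, hc⟩ := hcon
    have hres : X *ᵥ βstar + (fun i => ξ i ω) - X *ᵥ (βstar + c fun i => ξ i ω) =
        (fun i => ξ i ω) - X *ᵥ c fun i => ξ i ω := by
      rw [Matrix.mulVec_add]; abel
    refine hω ⟨⟨fun i hi => ?_, fun i hi => ?_, fun i hi => ?_, fun j => ?_⟩, fun i => ?_⟩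
    · simp [hsupp i hi, hcT _ i hi]
    · rw [hres]; exact hcorth _ i hi
    · have h1 := hlarge i hi
      have h2 : |(c fun i => ξ i ω) i| < 1.97 * τ := hc i
      have h3 := abs_sub_abs_le_abs_sub (βstar i) (-(c fun i => ξ i ω) i)
      rw [abs_neg, sub_neg_eq_add] at h3
      rw [Pi.add_apply]
      linarith
    · rw [hres]; exact (hw j).le
    · rw [Pi.add_apply, add_sub_cancel_left]; exact (hc i).le
  refine (measureReal_mono hsub).trans ((measureReal_union_le _ _).trans ?_)
  have hsum : ∀ L : (Fin n → ℝ) →ₗ[ℝ] (Fin p → ℝ),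
      (∀ j v, |(LinearMap.proj j ∘ₗ L : (Fin n → ℝ) →ₗ[ℝ] ℝ) v| ≤ C * l2norm v) →
      μ.real (⋃ j, {ω | 1.97 * τ ≤
        |(LinearMap.proj j ∘ₗ L : (Fin n → ℝ) →ₗ[ℝ] ℝ) fun i => ξ i ω|}) ≤
        p * (2 * Real.exp (-1.016 * Real.log p)) := fun L hL => by
    refine (measureReal_iUnion_fintype_le _).trans
      ((Finset.sum_le_sum fun j _ => htail _ (hL j)).trans ?_)
    simp
  have h1 := hsum W hWle
  have h2 := hsum c hcle
  linarith

end OracleFit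

/-! ### Constants and conclusion -/

lemma four_mul_exp_neg_log_le {p sstar : ℕ} (hp : 4 ^ 200 ≤ p) (hs : 1 ≤ sstar) :
    4 * p * Real.exp (-1.016 * Real.log p) ≤ ((sstar : ℝ) / p) ^ (0.01 : ℝ) := by
  have hp' : (4 : ℝ) ^ 200 ≤ p := by exact_mod_cast hp
  have hp0 : (0 : ℝ) < p := lt_of_lt_of_le (by positivity) hp'
  have hlog : 200 * Real.log 4 ≤ Real.log p := by
    have := Real.log_le_log (by positivity) hp'
    rwa [Real.log_pow, Nat.cast_ofNat] at this
  have hlog4 : 0 < Real.log 4 := Real.log_pos (by norm_num)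
  have hs' : (1 : ℝ) ≤ sstar := by exact_mod_cast hs
  calc 4 * p * Real.exp (-1.016 * Real.log p)
      = Real.exp (Real.log 4) * Real.exp (Real.log p) * Real.exp (-1.016 * Real.log p) := by
        rw [Real.exp_log (by norm_num), Real.exp_log hp0]
    _ = Real.exp (Real.log 4 + Real.log p + -1.016 * Real.log p) := by
        rw [Real.exp_add, Real.exp_add]
    _ ≤ Real.exp (Real.log (p : ℝ)⁻¹ * 0.01) := by
        rw [Real.exp_le_exp, Real.log_inv]
        -- It remains that `log 4 ≤ 0.006 log p`, which holds since `0.006 * 200 = 1.2`.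
        linarith
    _ = ((p : ℝ)⁻¹) ^ (0.01 : ℝ) := by rw [Real.rpow_def_of_pos (by positivity)]
    _ ≤ _ := by
        gcongr
        rw [inv_eq_one_div]
        gcongr

lemma mul_sqrt_le_two_pow {K s : ℝ} {t : ℕ} (hK : 2 ≤ K) (hs : 1 ≤ s)
    (ht : 2 * Real.log (K ^ 2 * s) ≤ (t + 1 : ℕ)) : K * Real.sqrt s ≤ 2 ^ t := by
  have hKs : 0 < K ^ 2 * s := by positivity
  -- The factor `2` in front of the logarithm is enough because `2 log 2 ≥ 1`.
  have h1 : K ^ 2 * s ≤ 2 ^ (t + 1) := by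
    rw [← Real.log_le_log_iff hKs (by positivity), Real.log_pow]
    have h2 := Real.log_two_gt_d9
    have h3 : (0 : ℝ) ≤ (t + 1 : ℕ) := by positivity
    nlinarith
  have h2 : Real.sqrt s ≤ s := by
    rw [Real.sqrt_le_left (by linarith)]
    nlinarith
  have h3 : 2 * (K * Real.sqrt s) ≤ K ^ 2 * s := by
    calc 2 * (K * Real.sqrt s) ≤ K * (K * s) := by gcongr
      _ = _ := by ring
  rw [pow_succ 2 t] at h1
  linarith

theorem theorem5 :
    ∃ p₀ : ℕ, ∀ C₀ C₁ : ℝ, 0 < C₀ → 0 < C₁ → ∃ C₂ C₃ : ℝ, 0 < C₂ ∧ 0 < C₃ ∧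
      ∀ (n p sstar s smax : ℕ), 0 < n → p₀ ≤ p → 1 ≤ sstar → sstar ≤ s → s ≤ 4 * sstar →
        s ≤ smax → smax ≤ p →
        C₀ * smax * Real.log ((p : ℝ) / smax) ≤ n →
      ∀ (X : Matrix (Fin n) (Fin p) ℝ),
        (∀ j, l2norm (fun i => X i j) = Real.sqrt n) →
      ∀ (δ ε : ℝ), RIP X (3 * s) δ → 0 < ε → ε < 1 → δ < min (ε ^ 2) 0.005 →
      ∀ (σ lam : ℝ), 0 < σ →
        (1 + 3 * ε) * σ * Real.sqrt (2 * Real.log ((p : ℝ) / sstar) / n) ≤ lam →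
        max C₁ 4 * σ * Real.sqrt (2 * Real.log p / n) ≤ lam →
      ∀ (Ω : Type*) [MeasurableSpace Ω] (μ : Measure Ω) [IsProbabilityMeasure μ]
        (ξ : Fin n → Ω → ℝ), IsSubGaussianNoise μ ξ σ →
      ∀ βstar ∈ signalClass p sstar lam,
      ∀ (β : Ω → ℕ → Fin p → ℝ) (S : Ω → ℕ → Finset (Fin p)),
        (∀ ω, IsHTPRun X (X *ᵥ βstar + fun i => ξ i ω) s (β ω) (S ω)) →
        (∀ᵐ ω ∂μ, l2norm (β ω 0 - βstar) ≤
            C₁ * σ * Real.sqrt (sstar * Real.log ((p : ℝ) / sstar) / n) ∧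
          (vsupp (β ω 0)).card ≤ s) →
      ∀ t : ℕ, 2 * Real.log (C₂ ^ 2 * sstar) ≤ t →
        (s = sstar → (vsupp βstar).card = sstar →
          μ.real {ω | minSignal (S ω t) (β ω t) <
              max (C₁ - 2) 2 * σ * Real.sqrt (2 * Real.log p / n)} ≤
            ((sstar : ℝ) / p) ^ C₃) ∧
        (sstar < s →
          μ.real {ω | 2 * σ * Real.sqrt (2 * Real.log p / n) ≤
              minSignal (S ω t) (β ω t)} ≤
            ((sstar : ℝ) / p) ^ C₃) := by
  -- In `C₂ = C₁ + 2`, the term `C₁` pays for the distance from the start to the signal and `2` for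
  -- that from the signal to the oracle fit, both in units of `τ √sstar`.
  refine ⟨4 ^ 200, fun C₀ C₁ _ hC₁ => ⟨C₁ + 2, 0.01, by positivity, by norm_num, ?_⟩⟩
  intro n p sstar s smax hn hp hsstar hss _ _ _ _ X hcol δ ε hX _ _ hδ σ lam hσ _ hlam Ω _ μ _ ξ
    hξ βstar hβstar β S hrun hinit t ht
  have hδ : δ < 0.005 := hδ.trans_le (min_le_right _ _)
  have hn' : (0 : ℝ) < n := by exact_mod_cast hn
  have hp1 : 1 < p := lt_of_lt_of_le (by norm_num) hp
  have hlogp : 0 < Real.log p := Real.log_pos (by exact_mod_cast hp1)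
  have hs1 : (1 : ℝ) ≤ sstar := by exact_mod_cast hsstar
  set τ := σ * Real.sqrt (2 * Real.log p / n) with hτ
  have hτ0 : 0 < τ := by positivity
  rw [mul_assoc, ← hτ] at hlam
  simp only [mul_assoc (max (C₁ - 2) 2) σ, mul_assoc 2 σ, ← hτ]
  obtain ⟨hTcard, hTlarge⟩ := hβstar
  have hTs : (vsupp βstar).card ≤ s := hTcard.trans hss
  have hC₁4 : ∀ i ∈ vsupp βstar, max C₁ 4 * τ ≤ |βstar i| := fun i hi =>
    hlam.trans (hTlarge i hi)
  obtain ⟨bhat, hbad⟩ := exists_isSeparatedFit hn hp1 hcol hX hδ hσ hξ (βstar := βstar)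
    (by omega) hτ fun i hi => le_trans (by gcongr; exact le_max_right _ _) (hC₁4 i hi)
  have hbad := hbad.trans (four_mul_exp_neg_log_le hp hsstar)
  -- The first `t` steps contract the error and the last one selects the support. The requirement
  -- forces at least one step because `(C₁ + 2)² sstar > 1`.
  obtain ⟨t, rfl⟩ : ∃ u, t = u + 1 := by
    refine ⟨t - 1, ?_⟩
    have : 0 < Real.log ((C₁ + 2) ^ 2 * sstar) := Real.log_pos (by nlinarith)
    have : (0 : ℝ) < t := by linarith
    have : 0 < t := by exact_mod_cast this
    omega
  have hpow := mul_sqrt_le_two_pow (by linarith) hs1 ht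
  have hstart : ∀ ω, l2norm (β ω 0 - βstar) ≤
      C₁ * σ * Real.sqrt (sstar * Real.log ((p : ℝ) / sstar) / n) →
      IsSeparatedFit X (X *ᵥ βstar + fun i => ξ i ω) (vsupp βstar) (bhat ω) τ →
      (∀ i, |bhat ω i - βstar i| ≤ 1.97 * τ) →
      l2norm (β ω 0 - bhat ω) / 2 ^ t ≤ 8 * τ := by
    intro ω h0 hfit hclose
    have h1 : C₁ * σ * Real.sqrt (sstar * Real.log ((p : ℝ) / sstar) / n) ≤
        C₁ * Real.sqrt sstar * τ := by
      have : Real.sqrt (sstar * Real.log ((p : ℝ) / sstar) / n) ≤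
          Real.sqrt sstar * Real.sqrt (2 * Real.log p / n) := by
        rw [← Real.sqrt_mul (by positivity), ← mul_div_assoc]
        gcongr
        have : Real.log ((p : ℝ) / sstar) ≤ Real.log p :=
          Real.log_le_log (by positivity) (div_le_self (by positivity) hs1)
        linarith
      calc _ ≤ C₁ * σ * (Real.sqrt sstar * Real.sqrt (2 * Real.log p / n)) := by gcongr
        _ = _ := by rw [hτ]; ring
    have h2 : l2norm (βstar - bhat ω) ≤ 2 * Real.sqrt sstar * τ := by
      have e : bhat ω - βstar = coordRestrict (vsupp βstar) (bhat ω - βstar) := by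
        ext i
        by_cases hi : i ∈ vsupp βstar
        · rw [coordRestrict_of_mem hi]
        · have : βstar i = 0 := by simpa [vsupp] using hi
          rw [coordRestrict_of_notMem hi, Pi.sub_apply, hfit.supp i hi, this, sub_zero]
      rw [l2norm_sub_rev, e]
      have := l2norm_coordRestrict_le_of_abs_le (A := vsupp βstar) (v := bhat ω - βstar)
        (r := 1.97 * τ) (by positivity) fun i _ => hclose i
      refine this.trans ?_
      calc 1.97 * τ * Real.sqrt (vsupp βstar).card ≤ 2 * τ * Real.sqrt sstar :=
            mul_le_mul (by linarith) (Real.sqrt_le_sqrt (by exact_mod_cast hTcard))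
              (Real.sqrt_nonneg _) (by positivity)
        _ = _ := by ring
    have h3 := l2norm_add_le (β ω 0 - βstar) (βstar - bhat ω)
    rw [sub_add_sub_cancel] at h3
    rw [div_le_iff₀ (by positivity)]
    have h4 := mul_le_mul_of_nonneg_right hpow hτ0.le
    have h5 : 0 ≤ 2 ^ t * τ := by positivity
    linarith
  have hmono : ∀ E : Set Ω, (∀ ω ∈ E, l2norm (β ω 0 - βstar) ≤
      C₁ * σ * Real.sqrt (sstar * Real.log ((p : ℝ) / sstar) / n) → (vsupp (β ω 0)).card ≤ s →
      IsSeparatedFit X (X *ᵥ βstar + fun i => ξ i ω) (vsupp βstar) (bhat ω) τ →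
      (∀ i, |bhat ω i - βstar i| ≤ 1.97 * τ) → False) →
      μ.real E ≤ ((sstar : ℝ) / p) ^ (0.01 : ℝ) := by
    intro E hE
    refine le_trans ?_ hbad
    refine ENNReal.toReal_mono (measure_ne_top _ _) (measure_mono_ae ?_)
    -- Comparing the events almost everywhere uses the start condition without requiring them to be
    -- measurable.
    filter_upwards [hinit] with ω hω hωE
    exact fun hgood => hE ω hωE hω.1 hω.2 hgood.1 hgood.2
  constructor
  · intro hs hcard
    refine hmono _ fun ω hω h0 hc hfit hclose => ?_
    have hTeq : (vsupp βstar).card = s := by rw [hcard, hs]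
    obtain ⟨hSt, hβt⟩ := (hrun ω).eq_of_card_eq hn hX hδ hTeq hτ0 hfit hc
      (hstart ω h0 hfit hclose)
    have hω : minSignal (S ω (t + 1)) (β ω (t + 1)) < max (C₁ - 2) 2 * τ := hω
    refine (not_le.2 hω) ?_
    rw [hSt, hβt]
    have hne : (vsupp βstar).Nonempty := Finset.card_pos.1 (by omega)
    refine le_csInf (hne.to_set.image _) ?_
    rintro _ ⟨i, hi, rfl⟩
    have h1 := hC₁4 i hi
    have h2 := hclose i
    have h3 := abs_sub_abs_le_abs_sub (βstar i) (bhat ω i)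
    rw [abs_sub_comm] at h3
    -- The claimed level is the signal level minus `2`, and the oracle fit loses only `1.97 τ`.
    have h4 : max (C₁ - 2) 2 = max C₁ 4 - 2 := by
      rw [← max_sub_sub_right]; norm_num
    rw [h4]
    simp only
    linarith
  · intro hs
    refine hmono _ fun ω hω h0 hc hfit hclose => ?_
    have hlt := (hrun ω).minSignal_lt hn hX hδ (by omega) hτ0 hfit hc (hstart ω h0 hfit hclose)
    have hω : 2 * τ ≤ minSignal (S ω (t + 1)) (β ω (t + 1)) := hω
    linarith
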